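/- For $x\in\mathbb{R}$ let $$g(x):=\frac1\pi\int_0^\infty \exp\left(-\tfrac43 t^{3/2}\right)\cos\left(xt+\tfrac43 t^{3/2}\right)\,\mathrm{d}t,$$ and for $b>0$, $\mu\in\mathbb{R}$ let $$\alpha(b,\mu):=\frac{\int_0^\infty a^{-1/2}\,g(\mu-a)\exp\left(\tfrac{(\mu-a)^3}{6}\right)\exp\left(-\tfrac{b^2}{2a}\right)\mathrm{d}a}{\int_0^\infty a^{-3/2}\,g(\mu-a)\exp\left(\tfrac{(\mu-a)^3}{6}\right)\exp\left(-\tfrac{b^2}{2a}\right)\mathrm{d}a},\qquad \alpha(0,\mu):=0.$$ Let $W$ be a standard Brownian motion on a probability space $(\Omega,P)$, with natural filtration $\mathcal{F}^W$. For $\lambda\in\mathbb{R}$, say that a pair $(Z,K)$ of real-valued processes indexed by $[0,\infty)$ is a solution if, almost surely: $Z$ is continuous and non-negative; $K$ is continuous and non-decreasing with $K(0)=0$ (so $K$ is non-negative too); $\int_0^\infty Z(t)\,\mathrm{d}K(t)=0$; $Z(0)=0$; and, for all $t\ge0$, the function $s\mapsto \lambda-s-\alpha(Z(s),\lambda-s)$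 is integrable on $[0,t]$ and $$Z(t)=\int_0^t\left[\lambda-s-\alpha\left(Z(s),\lambda-s\right)\right]\mathrm{d}s+W(t)+K(t).$$ In other words, $\mathrm{d}Z(t)=[\lambda-t-\alpha(Z(t),\lambda-t)]\,\mathrm{d}t+\mathrm{d}W(t)+\mathrm{d}K(t)$ with $Z(0)=0$, where $K$ is the local time of $Z$ at zero. Then for each $\lambda\in\mathbb{R}$ there exists a unique pair $(Z^\lambda,K^\lambda)$ of non-negative $\mathcal{F}^W$-adapted processes that is a solution. Uniqueness is up to indistinguishability: any solution $(Z',K')$ adapted to $\mathcal{F}^W$, or more generally to the $P$-completion of $\mathcal{F}^W$, satisfies, almost surely, $Z'(t)=Z^\lambda(t)$ and $K'(t)=K^\lambda(t)$ for all $t\ge0$. -/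

import Mathlib

open MeasureTheory ProbabilityTheory
open scoped NNReal ENNReal

noncomputable section

namespace ForestDiffusion

/-- The density of a stable law with exponent `3/2`,
`g(x) = (1/π) ∫₀^∞ exp(-(4/3) t^{3/2}) cos(x t + (4/3) t^{3/2}) dt`. -/
def g (x : ℝ) : ℝ :=
  (1 / Real.pi) * ∫ t in Set.Ioi (0 : ℝ),
    Real.exp (-(4 / 3) * t ^ (3 / 2 : ℝ)) * Real.cos (x * t + (4 / 3) * t ^ (3 / 2 : ℝ))

/-- `J k b μ = ∫₀^∞ a^{-k/2} g(μ - a) exp((μ - a)³ / 6) exp(-b² / (2a)) da`. -/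
def J (k : ℕ) (b μ : ℝ) : ℝ :=
  ∫ a in Set.Ioi (0 : ℝ),
    a ^ (-(k : ℝ) / 2) * g (μ - a) * Real.exp ((μ - a) ^ 3 / 6) * Real.exp (-b ^ 2 / (2 * a))

/-- The drift correction `α(b, μ) = J₁(b, μ) / J₃(b, μ)` for `b > 0`. At `b = 0`, where the integral
in the denominator diverges, it is given its limiting value `0`. (Negative `b` is never used.) -/
def α (b μ : ℝ) : ℝ :=
  if 0 < b then J 1 b μ / J 3 b μ else 0

/-- The drift `λ - s - α(x, λ - s)` at time `s` and height `x`. -/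
def drift (lam s x : ℝ) : ℝ :=
  lam - s - α x (lam - s)

/-- The path `z` is continuous, non-negative and started from `0`, the path `k` is continuous,
non-decreasing and vanishes at `0`, the integral `∫₀^∞ z dk` is zero, and
`z(t) = ∫₀ᵗ [λ - s - α(z(s), λ - s)] ds + w(t) + k(t)` for all `t ≥ 0`. (That `k` is non-negative
follows.) The measure `dk` on `[0, ∞)` is the Lebesgue-Stieltjes measure of `k`, for which
`(s, t]` has mass `k(t) - k(s)` and `{0}` has mass `0`. -/
structure IsReflectedPath (lam : ℝ) (w z k : ℝ≥0 → ℝ) : Prop where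
  z_cont : Continuous z
  z_nonneg : ∀ t, 0 ≤ z t
  z_zero : z 0 = 0
  k_cont : Continuous k
  k_mono : Monotone k
  k_zero : k 0 = 0
  reflect : ∫⁻ t, ENNReal.ofReal (z t) ∂k_mono.stieltjesFunction.measure = 0
  drift_integrable : ∀ t : ℝ≥0,
    IntervalIntegrable (fun s : ℝ => drift lam s (z s.toNNReal)) volume 0 t
  equation : ∀ t : ℝ≥0, z t = (∫ s in (0 : ℝ)..t, drift lam s (z s.toNNReal)) + w t + k t

/-- The pair of processes `(Z, K)` solves, almost surely, the reflected equation
`dZ(t) = [λ - t - α(Z(t), λ - t)] dt + dW(t) + dK(t)`, `Z(0) = 0`, driven by `W`, where `K` is the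
local time of `Z` at zero. -/
def IsReflectedSolution {Ω : Type*} [MeasurableSpace Ω] (P : Measure Ω) (lam : ℝ)
    (W Z K : ℝ≥0 → Ω → ℝ) : Prop :=
  ∀ᵐ ω ∂P, IsReflectedPath lam (fun t => W t ω) (fun t => Z t ω) (fun t => K t ω)

end ForestDiffusion

end

/-! The equation is solved path by path. If `α` is nondecreasing in its first argument, the drift is
nonincreasing in space, and two solutions driven by the same path cannot separate
(`IsReflectedPath.sub_le`). If `α` is moreover locally Lipschitz there, Picard iteration through the
Skorokhod reflection map solves the equation for every continuous path started at `0`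
(`exists_isReflectedPath`).

Both properties of `α` come from reading `α b μ` as the mean of `a` under the weight `jIntegrand 3 b
μ`, which must be positive. Raising `b` multiplies the weight by an increasing function of `a`, so
the mean grows (`α_le_α`). Quantifying this, with `J 1` bounded, `J 3` at least of order `1 / b` and
`J 5` at most of order `1 / b ^ 3`, gives `exists_lipschitz_α`.

Positivity of the weight is `g_pos`. Nonnegativity (`g_nonneg`) holds because `g` is the Fourier
transform of a limit of characteristic functions of (damped) random walks, built from a power series
with nonnegative coefficients. A zero of a nonnegative `g` would be a double zero; the linear
equation `g_ode` would then force `g = 0`, against `g_zero_pos`.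

For adaptedness, the solution at time `t` is a locally Lipschitz function of the driving path on
`[0, t]`. Replacing the path by Bernstein polynomials of finitely many samples exhibits it as a
limit of continuous functions of values of `W` at times up to `t`. -/

noncomputable section

namespace ForestDiffusion

open Set Filter Topology

/-! ### The function `g`: derivatives and a linear differential equation. -/

/-- The exponent `(4 / 3) t ^ (3 / 2)`. -/
def expo (t : ℝ) : ℝ := (4 / 3) * t ^ (3 / 2 : ℝ)

lemma continuous_expo : Continuous expo := by
  unfold expo
  exact continuous_const.mul (Real.continuous_rpow_const (by norm_num))

lemma g_eq (x : ℝ) :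
    g x = (1 / Real.pi) * ∫ t in Ioi (0 : ℝ), Real.exp (-expo t) * Real.cos (x * t + expo t) := by
  simp only [g, expo, neg_mul]

lemma integrableOn_rpow_mul_exp_neg_expo {s : ℝ} (hs : -1 < s) :
    IntegrableOn (fun t => t ^ s * Real.exp (-expo t)) (Ioi 0) := by
  have := integrableOn_rpow_mul_exp_neg_mul_rpow (p := 3 / 2) (b := 4 / 3) hs (by norm_num)
    (by norm_num)
  simpa only [expo, neg_mul] using this

lemma integrableOn_exp_neg_expo : IntegrableOn (fun t => Real.exp (-expo t)) (Ioi 0) := by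
  simpa using integrableOn_rpow_mul_exp_neg_expo (s := 0) (by norm_num)

lemma integrableOn_id_mul_exp_neg_expo : IntegrableOn (fun t => t * Real.exp (-expo t)) (Ioi 0) := by
  simpa using integrableOn_rpow_mul_exp_neg_expo (s := 1) (by norm_num)

lemma integrableOn_sq_mul_exp_neg_expo :
    IntegrableOn (fun t => t ^ 2 * Real.exp (-expo t)) (Ioi 0) := by
  simpa using integrableOn_rpow_mul_exp_neg_expo (s := 2) (by norm_num)

lemma abs_g_le (x : ℝ) : |g x| ≤ (1 / Real.pi) * ∫ t in Ioi (0 : ℝ), Real.exp (-expo t) := by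
  rw [g_eq, abs_mul, abs_of_nonneg (by positivity : (0 : ℝ) ≤ 1 / Real.pi)]
  gcongr
  rw [← Real.norm_eq_abs]
  refine norm_integral_le_of_norm_le (f := fun t => Real.exp (-expo t) * Real.cos (x * t + expo t))
    integrableOn_exp_neg_expo (.of_forall fun t => ?_)
  rw [norm_mul, Real.norm_of_nonneg (Real.exp_pos _).le]
  exact mul_le_of_le_one_right (Real.exp_pos _).le (Real.abs_cos_le_one _)

/-- The first derivative of `g`. -/
def g₁ (x : ℝ) : ℝ :=
  (1 / Real.pi) * ∫ t in Ioi (0 : ℝ), -(t * Real.exp (-expo t) * Real.sin (x * t + expo t))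

/-- The second derivative of `g`. -/
def g₂ (x : ℝ) : ℝ :=
  (1 / Real.pi) * ∫ t in Ioi (0 : ℝ), -(t ^ 2 * Real.exp (-expo t) * Real.cos (x * t + expo t))

lemma integrableOn_mul_of_abs_le_one {u v : ℝ → ℝ} (hu : IntegrableOn u (Ioi 0))
    (hv : Continuous v) (h1 : ∀ t, |v t| ≤ 1) : IntegrableOn (fun t => u t * v t) (Ioi 0) :=
  Integrable.mul_bdd (c := 1) hu hv.aestronglyMeasurable (.of_forall h1)

lemma hasDerivAt_g (x : ℝ) : HasDerivAt g (g₁ x) x := by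
  have hc := continuous_expo
  have key := hasDerivAt_integral_of_dominated_loc_of_deriv_le
    (μ := volume.restrict (Ioi (0 : ℝ))) (x₀ := x) (s := univ)
    (F := fun x t => Real.exp (-expo t) * Real.cos (x * t + expo t))
    (F' := fun x t => -(t * Real.exp (-expo t) * Real.sin (x * t + expo t)))
    (bound := fun t => t * Real.exp (-expo t)) univ_mem
    (.of_forall fun y => by fun_prop)
    (integrableOn_mul_of_abs_le_one integrableOn_exp_neg_expo (by fun_prop)
      fun t => Real.abs_cos_le_one _)
    (by fun_prop) ?_ integrableOn_id_mul_exp_neg_expo ?_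
  · have := key.2.const_mul (1 / Real.pi)
    rw [show g = fun x => (1 / Real.pi) * ∫ t in Ioi (0 : ℝ),
      Real.exp (-expo t) * Real.cos (x * t + expo t) from funext g_eq]
    exact this
  · filter_upwards [ae_restrict_mem measurableSet_Ioi] with t ht y _
    have ht' : (0 : ℝ) < t := ht
    rw [norm_neg, norm_mul, Real.norm_of_nonneg (by positivity)]
    exact mul_le_of_le_one_right (by positivity) (Real.abs_sin_le_one _)
  · refine .of_forall fun t y _ => ?_
    have h1 : HasDerivAt (fun y => y * t + expo t) t y := by
      simpa using ((hasDerivAt_id y).mul_const t).add_const (expo t)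
    exact (h1.cos.const_mul (Real.exp (-expo t))).congr_deriv (by ring)

lemma hasDerivAt_g₁ (x : ℝ) : HasDerivAt g₁ (g₂ x) x := by
  have hc := continuous_expo
  have key := hasDerivAt_integral_of_dominated_loc_of_deriv_le
    (μ := volume.restrict (Ioi (0 : ℝ))) (x₀ := x) (s := univ)
    (F := fun x t => -(t * Real.exp (-expo t) * Real.sin (x * t + expo t)))
    (F' := fun x t => -(t ^ 2 * Real.exp (-expo t) * Real.cos (x * t + expo t)))
    (bound := fun t => t ^ 2 * Real.exp (-expo t)) univ_mem
    (.of_forall fun y => by fun_prop)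
    (integrableOn_mul_of_abs_le_one integrableOn_id_mul_exp_neg_expo (by fun_prop)
      fun t => Real.abs_sin_le_one _).neg
    (by fun_prop) ?_ integrableOn_sq_mul_exp_neg_expo ?_
  · exact key.2.const_mul (1 / Real.pi)
  · refine .of_forall fun t y _ => ?_
    rw [norm_neg, norm_mul, Real.norm_of_nonneg (by positivity)]
    exact mul_le_of_le_one_right (by positivity) (Real.abs_cos_le_one _)
  · refine .of_forall fun t y _ => ?_
    have h1 : HasDerivAt (fun y => y * t + expo t) t y := by
      simpa using ((hasDerivAt_id y).mul_const t).add_const (expo t)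
    exact (h1.sin.const_mul (t * Real.exp (-expo t))).neg.congr_deriv (by ring)

lemma continuous_g : Continuous g :=
  continuous_iff_continuousAt.2 fun x => (hasDerivAt_g x).continuousAt

lemma tendsto_rpow_mul_exp_neg_expo (s : ℝ) :
    Tendsto (fun t => t ^ s * Real.exp (-expo t)) atTop (𝓝 0) := by
  have h := rpow_mul_exp_neg_mul_rpow_isLittleO_exp_neg s (b := 4 / 3) (p := 3 / 2)
    (by norm_num) (by norm_num)
  refine (h.trans_tendsto ?_).congr fun t => by simp only [expo, neg_mul]
  have : Tendsto (fun x : ℝ => (1 / 2 : ℝ) * x) atTop atTop :=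
    tendsto_id.const_mul_atTop (by norm_num)
  exact (Real.tendsto_exp_neg_atTop_nhds_zero.comp this).congr fun t => by simp

/-- A primitive, up to a constant factor, of the combination of integrands behind `g_ode`. -/
def odePrimitive (x t : ℝ) : ℝ :=
  Real.exp (-expo t) * ((t ^ (3 / 2 : ℝ) / 4 - x * t / 8) * Real.cos (x * t + expo t)
    - (t ^ (3 / 2 : ℝ) / 4 + 3 / 16) * Real.sin (x * t + expo t))

lemma hasDerivAt_odePrimitive (x : ℝ) {t : ℝ} (ht : 0 < t) :
    HasDerivAt (odePrimitive x)
      (-(t ^ 2 * Real.exp (-expo t) * Real.cos (x * t + expo t))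
        - x ^ 2 / 8 * -(t * Real.exp (-expo t) * Real.sin (x * t + expo t))
        - 5 / 16 * x * (Real.exp (-expo t) * Real.cos (x * t + expo t))) t := by
  have hp : HasDerivAt (fun t : ℝ => t ^ (3 / 2 : ℝ)) ((3 / 2) * t ^ (1 / 2 : ℝ)) t := by
    have := Real.hasDerivAt_rpow_const (x := t) (p := 3 / 2) (Or.inl ht.ne')
    norm_num at this ⊢
    exact this
  have he : HasDerivAt expo (2 * t ^ (1 / 2 : ℝ)) t :=
    (hp.const_mul (4 / 3)).congr_deriv (by ring)
  have hθ : HasDerivAt (fun t => x * t + expo t) (x + 2 * t ^ (1 / 2 : ℝ)) t := by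
    simpa only [mul_one] using! ((hasDerivAt_id t).const_mul x).add he
  have hlin : HasDerivAt (fun t : ℝ => x * t / 8) (x / 8) t := by
    simpa using ((hasDerivAt_id t).const_mul x).div_const 8
  have h := he.neg.exp.mul ((((hp.div_const 4).sub hlin).mul hθ.cos).sub
    (((hp.div_const 4).add_const (3 / 16)).mul hθ.sin))
  refine h.congr_deriv ?_
  have h1 : t ^ (3 / 2 : ℝ) = t * t ^ (1 / 2 : ℝ) := by
    rw [show (3 / 2 : ℝ) = 1 + 1 / 2 by norm_num, Real.rpow_add ht, Real.rpow_one]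
  -- In terms of `u = √t`, with the sine, cosine and exponential generalized, the claim is a
  -- polynomial identity.
  obtain ⟨u, hu⟩ : ∃ u, u = t ^ (1 / 2 : ℝ) := ⟨_, rfl⟩
  have h2 : t = u ^ 2 := by rw [hu, ← Real.rpow_natCast, ← Real.rpow_mul ht.le]; norm_num
  simp only [Pi.sub_apply, Pi.mul_apply, Pi.neg_apply, h1, ← hu]
  generalize Real.cos (x * t + expo t) = C
  generalize Real.sin (x * t + expo t) = S
  generalize Real.exp (-expo t) = E
  rw [h2]
  ring

lemma tendsto_odePrimitive (x : ℝ) : Tendsto (odePrimitive x) atTop (𝓝 0) := by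
  have h0 := (tendsto_rpow_mul_exp_neg_expo 0).const_mul (3 / 16)
  have h1 := (tendsto_rpow_mul_exp_neg_expo 1).const_mul (|x| / 8)
  have h2 := (tendsto_rpow_mul_exp_neg_expo (3 / 2)).const_mul (1 / 2)
  have h := (h0.add h1).add h2
  simp only [mul_zero, add_zero] at h
  refine squeeze_zero_norm' ?_ h
  filter_upwards [eventually_gt_atTop 0] with t ht
  have hr : 0 < t ^ (3 / 2 : ℝ) := Real.rpow_pos_of_pos ht _
  have hE := Real.exp_pos (-expo t)
  rw [odePrimitive, norm_mul, Real.norm_of_nonneg hE.le, Real.norm_eq_abs]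
  have hA : |(t ^ (3 / 2 : ℝ) / 4 - x * t / 8) * Real.cos (x * t + expo t)|
      ≤ t ^ (3 / 2 : ℝ) / 4 + |x| * t / 8 := by
    rw [abs_mul]
    refine (mul_le_of_le_one_right (abs_nonneg _) (Real.abs_cos_le_one _)).trans ?_
    refine (abs_sub _ _).trans ?_
    rw [abs_of_pos (by positivity), abs_div, abs_mul, abs_of_pos ht, abs_of_pos (by norm_num : (0 : ℝ) < 8)]
  have hB : |(t ^ (3 / 2 : ℝ) / 4 + 3 / 16) * Real.sin (x * t + expo t)|
      ≤ t ^ (3 / 2 : ℝ) / 4 + 3 / 16 := by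
    rw [abs_mul, abs_of_pos (by positivity)]
    exact mul_le_of_le_one_right (by positivity) (Real.abs_sin_le_one _)
  have := (abs_sub _ _).trans (add_le_add hA hB)
  refine (mul_le_mul_of_nonneg_left this hE.le).trans_eq ?_
  rw [Real.rpow_zero, Real.rpow_one]
  ring

/-- Up to the factor `1 / π`, the difference of the two sides is the integral of the exact
derivative of `odePrimitive x`, which vanishes at `0` and at infinity. -/
lemma g_ode (x : ℝ) : g₂ x = x ^ 2 / 8 * g₁ x + 5 / 16 * x * g x := by
  have hc := continuous_expo
  have i0 : IntegrableOn (fun t => Real.exp (-expo t) * Real.cos (x * t + expo t)) (Ioi 0) :=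
    integrableOn_mul_of_abs_le_one integrableOn_exp_neg_expo (by fun_prop)
      fun t => Real.abs_cos_le_one _
  have i1 : IntegrableOn (fun t => -(t * Real.exp (-expo t) * Real.sin (x * t + expo t))) (Ioi 0) :=
    (integrableOn_mul_of_abs_le_one integrableOn_id_mul_exp_neg_expo (by fun_prop)
      fun t => Real.abs_sin_le_one _).neg
  have i2 : IntegrableOn (fun t => -(t ^ 2 * Real.exp (-expo t) * Real.cos (x * t + expo t)))
      (Ioi 0) :=
    (integrableOn_mul_of_abs_le_one integrableOn_sq_mul_exp_neg_expo (by fun_prop)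
      fun t => Real.abs_cos_le_one _).neg
  have hcont : Continuous (odePrimitive x) := by
    have : Continuous fun t : ℝ => t ^ (3 / 2 : ℝ) := Real.continuous_rpow_const (by norm_num)
    unfold odePrimitive
    fun_prop
  have key := integral_Ioi_of_hasDerivAt_of_tendsto hcont.continuousWithinAt
    (fun t ht => hasDerivAt_odePrimitive x ht)
    ((i2.sub (i1.const_mul (x ^ 2 / 8))).sub (i0.const_mul (5 / 16 * x))) (tendsto_odePrimitive x)
  have h0 : odePrimitive x 0 = 0 := by
    simp [odePrimitive, expo]
  have e1 := integral_sub (i2.sub (i1.const_mul (x ^ 2 / 8))) (i0.const_mul (5 / 16 * x))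
  have e2 := integral_sub i2 (i1.const_mul (x ^ 2 / 8))
  simp only [Pi.sub_apply] at e1 e2
  rw [e1, e2, integral_const_mul, integral_const_mul, h0] at key
  rw [g_eq, g₁, g₂]
  linear_combination (1 / Real.pi) * key

/-- Uniqueness for the first-order system of `g_ode`, compared with the zero solution on a bounded
interval containing both points, where the coefficients are bounded. -/
lemma g_eq_zero_of_double_zero {x₀ : ℝ} (h0 : g x₀ = 0) (h1 : g₁ x₀ = 0) (x : ℝ) : g x = 0 := by
  let M := |x| + |x₀| + 1
  let v : ℝ → ℝ × ℝ → ℝ × ℝ := fun t y => (y.2, t ^ 2 / 8 * y.2 + 5 / 16 * t * y.1)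
  have hLip : ∀ t ∈ Ioo (-M) M, LipschitzOnWith (M ^ 2 / 8 + 5 / 16 * M + 1).toNNReal (v t) univ := by
    intro t ht
    have htM : |t| ≤ M := (abs_lt.2 ht).le
    have hM : 0 ≤ M := by positivity
    refine LipschitzOnWith.of_dist_le_mul fun y _ z _ => ?_
    rw [Real.coe_toNNReal _ (by positivity)]
    have e1 : |y.1 - z.1| ≤ dist y z := le_max_left _ _
    have e2 : |y.2 - z.2| ≤ dist y z := le_max_right _ _
    have hd := dist_nonneg (x := y) (y := z)
    refine max_le ?_ ?_
    · refine e2.trans ?_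
      nlinarith [mul_nonneg (sq_nonneg M) hd, mul_nonneg hM hd]
    · change |t ^ 2 / 8 * y.2 + 5 / 16 * t * y.1 - (t ^ 2 / 8 * z.2 + 5 / 16 * t * z.1)| ≤ _
      rw [show t ^ 2 / 8 * y.2 + 5 / 16 * t * y.1 - (t ^ 2 / 8 * z.2 + 5 / 16 * t * z.1)
        = t ^ 2 / 8 * (y.2 - z.2) + 5 / 16 * t * (y.1 - z.1) by ring]
      refine (abs_add_le _ _).trans ?_
      rw [abs_mul, abs_mul, abs_mul, abs_of_nonneg (by positivity : 0 ≤ t ^ 2 / 8),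
        abs_of_pos (by norm_num : (0 : ℝ) < 5 / 16), ← sq_abs t]
      have : |t| ^ 2 / 8 * |y.2 - z.2| ≤ M ^ 2 / 8 * dist y z := by gcongr
      have : 5 / 16 * |t| * |y.1 - z.1| ≤ 5 / 16 * M * dist y z := by gcongr
      linarith
  have key := ODE_solution_unique_of_mem_Ioo (v := v) (s := fun _ => univ) (t₀ := x₀)
    (f := fun t => (g t, g₁ t)) (g := fun _ => (0, 0)) hLip
    (abs_lt.1 (by show |x₀| < |x| + |x₀| + 1; linarith [abs_nonneg x]))
    (fun t _ => ⟨(hasDerivAt_g t).prodMk ((hasDerivAt_g₁ t).congr_deriv (g_ode t)), mem_univ _⟩)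
    (fun t _ => ⟨by simpa [v] using! hasDerivAt_const t ((0 : ℝ), (0 : ℝ)), mem_univ _⟩)
    (by simp [h0, h1])
  have := key (x := x) (abs_lt.1 (by show |x| < |x| + |x₀| + 1; linarith [abs_nonneg x₀]))
  exact congrArg Prod.fst this

/-! ### Positivity of `g` at the origin, and reduction of positivity to nonnegativity. -/

lemma exp_neg_mul_cos_sub_sin_lt {x : ℝ} (hx : 0 < x) :
    Real.exp (-x) * (Real.cos x - Real.sin x) < 1 := by
  have h1 : Real.cos x - Real.sin x < Real.exp x := by
    have := Real.add_one_lt_exp hx.ne'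
    have := neg_le_of_abs_le ((Real.abs_sin_le_abs (x := x)).trans_eq (abs_of_pos hx))
    linarith [Real.cos_le_one x]
  calc _ < Real.exp (-x) * Real.exp x := by gcongr
    _ = 1 := by rw [← Real.exp_add]; simp

/-- Only the order `O(x)` at the origin matters: it makes the boundary term `Ψ` in `g_zero_pos`
vanish there. -/
lemma one_sub_exp_neg_mul_cos_sub_sin_le {x : ℝ} (hx : 0 ≤ x) :
    1 - Real.exp (-x) * (Real.cos x - Real.sin x) ≤ 2 * x + x ^ 2 / 2 := by
  have h1 := Real.add_one_le_exp (-x)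
  have h2 : Real.exp (-x) ≤ 1 := Real.exp_le_one_iff.2 (by linarith)
  have h3 := Real.one_sub_sq_div_two_le_cos (x := x)
  have h4 := Real.sin_le hx
  have h5 : Real.exp (-x) * (1 - x ^ 2 / 2 - x) ≤ Real.exp (-x) * (Real.cos x - Real.sin x) := by
    gcongr
  have h6 : Real.exp (-x) * (x ^ 2 / 2 + x) ≤ 1 * (x ^ 2 / 2 + x) := by gcongr
  linarith

/-- Since `H' = 4 √t f`, integrating `f` by parts produces the boundary term `Ψ` and the integral of
`H / (8 t ^ (3 / 2))`. The latter is `Q`, which increases because `H > 0`. -/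
lemma g_zero_pos : 0 < g 0 := by
  let H : ℝ → ℝ := fun t => 1 - Real.exp (-expo t) * (Real.cos (expo t) - Real.sin (expo t))
  let f : ℝ → ℝ := fun t => Real.exp (-expo t) * Real.cos (expo t)
  let Ψ : ℝ → ℝ := fun t => H t / (4 * t ^ (1 / 2 : ℝ))
  let Q : ℝ → ℝ := fun t => (∫ s in (0 : ℝ)..t, f s) - Ψ t
  have hce := continuous_expo
  have hf : Continuous f := by fun_prop
  have hexpo : ∀ t, 0 < t → 0 < expo t := fun t ht => by unfold expo; positivity
  have hH : ∀ t, 0 < t → 0 < H t := fun t ht =>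
    sub_pos.2 (exp_neg_mul_cos_sub_sin_lt (hexpo t ht))
  have hQ : ∀ t, 0 < t → HasDerivAt Q (H t / (8 * t ^ (3 / 2 : ℝ))) t := by
    intro t ht
    have hs : HasDerivAt (fun t : ℝ => t ^ (1 / 2 : ℝ)) ((1 / 2) * t ^ (-(1 / 2) : ℝ)) t := by
      have := Real.hasDerivAt_rpow_const (x := t) (p := 1 / 2) (Or.inl ht.ne')
      norm_num at this ⊢
      exact this
    have hp : HasDerivAt (fun t : ℝ => t ^ (3 / 2 : ℝ)) ((3 / 2) * t ^ (1 / 2 : ℝ)) t := by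
      have := Real.hasDerivAt_rpow_const (x := t) (p := 3 / 2) (Or.inl ht.ne')
      norm_num at this ⊢
      exact this
    have he : HasDerivAt expo (2 * t ^ (1 / 2 : ℝ)) t :=
      (hp.const_mul (4 / 3)).congr_deriv (by ring)
    have hr : t ^ (1 / 2 : ℝ) ≠ 0 := (Real.rpow_pos_of_pos ht _).ne'
    have hΨ := ((he.neg.exp.mul (he.cos.sub he.sin)).const_sub 1).div (hs.const_mul 4)
      (mul_ne_zero four_ne_zero hr)
    have hint := intervalIntegral.integral_hasDerivAt_right (hf.intervalIntegrable 0 t)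
      (hf.stronglyMeasurableAtFilter _ _) hf.continuousAt
    refine (hint.sub hΨ).congr_deriv ?_
    have h1 : t ^ (3 / 2 : ℝ) = t * t ^ (1 / 2 : ℝ) := by
      rw [show (3 / 2 : ℝ) = 1 + 1 / 2 by norm_num, Real.rpow_add ht, Real.rpow_one]
    have h2 : t ^ (-(1 / 2) : ℝ) = (t ^ (1 / 2 : ℝ))⁻¹ := Real.rpow_neg ht.le _
    obtain ⟨u, hu⟩ : ∃ u, u = t ^ (1 / 2 : ℝ) := ⟨_, rfl⟩
    have h3 : t = u ^ 2 := by rw [hu, ← Real.rpow_natCast, ← Real.rpow_mul ht.le]; norm_num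
    rw [← hu] at hr
    simp only [Pi.sub_apply, Pi.mul_apply, Pi.neg_apply, h1, h2, ← hu, H, f]
    generalize Real.cos (expo t) = C
    generalize Real.sin (expo t) = S
    generalize Real.exp (-expo t) = E
    rw [h3]
    field_simp
    ring
  have hmono : StrictMonoOn Q (Ioi 0) := by
    refine strictMonoOn_of_deriv_pos (convex_Ioi 0)
      (fun t ht => (hQ t ht).continuousAt.continuousWithinAt) fun t ht => ?_
    rw [interior_Ioi] at ht
    rw [(hQ t ht).deriv]
    have := hH t ht
    have : 0 < t := ht
    positivity
  have hQ0 : Tendsto Q (𝓝[>] 0) (𝓝 0) := by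
    have hΨ0 : Tendsto Ψ (𝓝[>] 0) (𝓝 0) := by
      have hb : Tendsto (fun t => 2 / 3 * t + t * expo t / 6) (𝓝[>] (0 : ℝ)) (𝓝 0) := by
        have : Continuous fun t => 2 / 3 * t + t * expo t / 6 := by fun_prop
        simpa using (this.tendsto 0).mono_left nhdsWithin_le_nhds
      refine squeeze_zero' ?_ ?_ hb
      · filter_upwards [self_mem_nhdsWithin] with t ht
        have := hH t ht
        have : (0 : ℝ) < t := ht
        positivity
      · filter_upwards [self_mem_nhdsWithin] with t ht
        have ht' : (0 : ℝ) < t := ht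
        have h1 : t ^ (3 / 2 : ℝ) = t * t ^ (1 / 2 : ℝ) := by
          rw [show (3 / 2 : ℝ) = 1 + 1 / 2 by norm_num, Real.rpow_add ht', Real.rpow_one]
        have hu : 0 < t ^ (1 / 2 : ℝ) := Real.rpow_pos_of_pos ht' _
        rw [div_le_iff₀ (by positivity)]
        refine (one_sub_exp_neg_mul_cos_sub_sin_le (hexpo t ht').le).trans_eq ?_
        simp only [expo, h1]
        ring
    have hI : Tendsto (fun t => ∫ s in (0 : ℝ)..t, f s) (𝓝[>] 0) (𝓝 0) := by
      have : Continuous fun t => ∫ s in (0 : ℝ)..t, f s :=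
        intervalIntegral.continuous_primitive (fun a b => hf.intervalIntegrable a b) 0
      simpa using (this.tendsto 0).mono_left nhdsWithin_le_nhds
    simpa using hI.sub hΨ0
  -- The limit at `0` gives only `0 ≤ Q 1`; strict growth from `1` to `2` supplies the strict
  -- inequality.
  have hQ1 : 0 ≤ Q 1 := by
    refine le_of_tendsto hQ0 ?_
    filter_upwards [Ioo_mem_nhdsGT (zero_lt_one (α := ℝ))] with t ht
    exact (hmono ht.1 (mem_Ioi.2 one_pos) ht.2).le
  have hfint : IntegrableOn f (Ioi 0) :=
    integrableOn_mul_of_abs_le_one integrableOn_exp_neg_expo (by fun_prop)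
      fun t => Real.abs_cos_le_one _
  have hlim := intervalIntegral_tendsto_integral_Ioi 0 hfint tendsto_id
  have hle : Q 2 ≤ ∫ t in Ioi (0 : ℝ), f t := by
    refine ge_of_tendsto hlim ?_
    filter_upwards [eventually_gt_atTop 2] with t ht
    have h1 := hmono (mem_Ioi.2 two_pos) (mem_Ioi.2 (two_pos.trans ht)) ht
    have h2 : 0 ≤ Ψ t := by
      have := hH t (two_pos.trans ht)
      have : 0 < t := two_pos.trans ht
      positivity
    have h3 : Q t = (∫ s in (0 : ℝ)..t, f s) - Ψ t := rfl
    simp only [id]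
    linarith
  have h12 := hmono (mem_Ioi.2 one_pos) (mem_Ioi.2 two_pos) one_lt_two
  rw [g_eq]
  simp only [zero_mul, zero_add]
  exact mul_pos (by positivity) (by linarith)

/-- A zero of a nonnegative function is a minimum, hence a double zero. -/
lemma g_pos_of_nonneg (h : ∀ x, 0 ≤ g x) (x : ℝ) : 0 < g x := by
  refine (h x).lt_of_ne' fun h0 => ?_
  have hmin : IsLocalMin g x := .of_forall fun y => by rw [h0]; exact h y
  have h1 : g₁ x = 0 := hmin.hasDerivAt_eq_zero (hasDerivAt_g x)
  exact g_zero_pos.ne' (g_eq_zero_of_double_zero h0 h1 0)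

/-! ### Nonnegativity of `g` as a limit of random walks. -/

/-- The half-line form of positivity of the Fourier transform of `ψ`, after Gaussian smoothing. -/
def FourierNonneg (ψ : ℝ → ℂ) : Prop :=
  ∀ x ε : ℝ, 0 < ε →
    0 ≤ ∫ t in Ioi (0 : ℝ), (ψ t * Complex.exp ((x * t : ℝ) * Complex.I)).re * Real.exp (-ε * t ^ 2)

lemma abs_re_mul_exp_le (z : ℂ) (y : ℝ) : |(z * Complex.exp (y * Complex.I)).re| ≤ ‖z‖ := by
  refine (Complex.abs_re_le_norm _).trans ?_
  rw [norm_mul, Complex.norm_exp_ofReal_mul_I, mul_one]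

lemma integrableOn_exp_neg_sq {ε : ℝ} (hε : 0 < ε) :
    IntegrableOn (fun t : ℝ => Real.exp (-ε * t ^ 2)) (Ioi 0) :=
  (integrable_exp_neg_mul_sq hε).integrableOn

/-- By evenness this is half of the Fourier transform of a Gaussian, which is again a Gaussian. -/
lemma integral_cos_mul_exp_neg_sq_nonneg (y : ℝ) {ε : ℝ} (hε : 0 < ε) :
    0 ≤ ∫ t in Ioi (0 : ℝ), Real.cos (y * t) * Real.exp (-ε * t ^ 2) := by
  let f : ℝ → ℝ := fun t => Real.cos (y * t) * Real.exp (-ε * t ^ 2)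
  have hf : Integrable f := by
    refine (integrable_exp_neg_mul_sq hε).bdd_mul (c := 1) (by fun_prop) (.of_forall fun t => ?_)
    exact Real.abs_cos_le_one _
  have h1 : ∫ t, f t = 2 * ∫ t in Ioi (0 : ℝ), f t := by
    have heven : ∫ t in Iic (0 : ℝ), f t = ∫ t in Ioi 0, f t := by
      rw [← neg_zero, ← integral_comp_neg_Ioi, neg_zero]
      simp [f]
    rw [← integral_add_compl (s := Ioi 0) measurableSet_Ioi hf, compl_Ioi, heven]
    ring
  have h2 : ((∫ t, f t : ℝ) : ℂ) = ((Real.pi / ε) ^ (1 / 2 : ℝ) * Real.exp (-y ^ 2 / (4 * ε)) : ℝ) := by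
    have h3 := fourierIntegral_gaussian (b := (ε : ℂ)) (by simpa using hε) (y : ℂ)
    have h4 : (∫ t, f t : ℝ) = (∫ t : ℝ, Complex.exp (Complex.I * y * t) *
        Complex.exp (-ε * t ^ 2)).re := by
      rw [← RCLike.re_eq_complex_re, ← integral_re]
      · refine integral_congr_ae (.of_forall fun t => ?_)
        simp only [RCLike.re_eq_complex_re, f]
        rw [show (-ε * t ^ 2 : ℂ) = ((-ε * t ^ 2 : ℝ) : ℂ) by push_cast; ring,
          ← Complex.ofReal_exp, Complex.re_mul_ofReal,
          show Complex.I * y * t = ((y * t : ℝ) : ℂ) * Complex.I by push_cast; ring,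
          Complex.exp_ofReal_mul_I_re]
      · refine (integrable_cexp_neg_mul_sq (b := ε) (by simpa using hε)).bdd_mul (c := 1)
          (by fun_prop) (.of_forall fun t => ?_)
        rw [show Complex.I * y * t = ((y * t : ℝ) : ℂ) * Complex.I by push_cast; ring,
          Complex.norm_exp_ofReal_mul_I]
    have h5 : (Real.pi / ε : ℂ) ^ (1 / 2 : ℂ) * Complex.exp (-y ^ 2 / (4 * ε))
        = ((Real.pi / ε) ^ (1 / 2 : ℝ) * Real.exp (-y ^ 2 / (4 * ε)) : ℝ) := by
      rw [Complex.ofReal_mul, Complex.ofReal_cpow (by positivity)]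
      push_cast
      rfl
    rw [h4, h3, h5, Complex.ofReal_re]
  rw [Complex.ofReal_inj] at h2
  have h3 : 0 ≤ ∫ t, f t := by rw [h2]; positivity
  linarith

/-- The monoid of nonnegative multiples of characters of the real line. -/
def scaledCharacters : Submonoid (ℝ → ℂ) where
  carrier := {ψ | ∃ c y : ℝ, 0 ≤ c ∧ ψ = fun t => (c : ℂ) * Complex.exp ((y * t : ℝ) * Complex.I)}
  one_mem' := ⟨1, 0, zero_le_one, by ext; simp⟩
  mul_mem' := by
    rintro _ _ ⟨c, y, hc, rfl⟩ ⟨c', y', hc', rfl⟩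
    refine ⟨c * c', y + y', mul_nonneg hc hc', ?_⟩
    ext t
    simp only [Pi.mul_apply]
    rw [mul_mul_mul_comm, ← Complex.exp_add]
    push_cast
    ring_nf

/-- The semiring generated by a monoid is its additive closure. Powers of trigonometric polynomials
with nonnegative coefficients thus come for free, and only single characters and sums need checking.
-/
lemma scaledCharacters_closure_props {ψ : ℝ → ℂ} (h : ψ ∈ scaledCharacters.subsemiringClosure) :
    Continuous ψ ∧ (∃ C, ∀ t, ‖ψ t‖ ≤ C) ∧ FourierNonneg ψ := by
  rw [Submonoid.subsemiringClosure_mem] at h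
  induction h using AddSubmonoid.closure_induction with
  | mem ψ hψ =>
    obtain ⟨c, y, hc, rfl⟩ := hψ
    refine ⟨by fun_prop, ⟨c, fun t => ?_⟩, fun x ε hε => ?_⟩
    · rw [norm_mul, Complex.norm_exp_ofReal_mul_I, mul_one, Complex.norm_of_nonneg hc]
    · have := mul_nonneg hc (integral_cos_mul_exp_neg_sq_nonneg (y + x) hε)
      rw [← integral_const_mul] at this
      refine this.trans_eq (integral_congr_ae (.of_forall fun t => ?_))
      simp only
      rw [mul_assoc, ← Complex.exp_add, Complex.re_ofReal_mul, ← add_mul, ← Complex.ofReal_add,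
        Complex.exp_ofReal_mul_I_re, mul_assoc, add_mul]
  | zero => exact ⟨continuous_const, ⟨0, by simp⟩, fun x ε _ => by simp⟩
  | add ψ φ _ _ h1 h2 =>
    obtain ⟨c1, ⟨C1, b1⟩, p1⟩ := h1
    obtain ⟨c2, ⟨C2, b2⟩, p2⟩ := h2
    refine ⟨c1.add c2, ⟨C1 + C2, fun t => (norm_add_le _ _).trans (add_le_add (b1 t) (b2 t))⟩, ?_⟩
    intro x ε hε
    have key : ∀ {ψ : ℝ → ℂ} {C : ℝ}, Continuous ψ → (∀ t, ‖ψ t‖ ≤ C) → IntegrableOn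
        (fun t => (ψ t * Complex.exp ((x * t : ℝ) * Complex.I)).re * Real.exp (-ε * t ^ 2))
        (Ioi 0) := by
      intro ψ C hc hb
      refine Integrable.bdd_mul (c := C) (integrableOn_exp_neg_sq hε) ?_ (.of_forall fun t => ?_)
      · exact (Complex.continuous_re.comp (by fun_prop)).aestronglyMeasurable
      · exact (abs_re_mul_exp_le _ _).trans (hb t)
    have := add_nonneg (p1 x ε hε) (p2 x ε hε)
    rw [← integral_add (key c1 b1) (key c2 b2)] at this
    refine this.trans_eq (integral_congr_ae (.of_forall fun t => ?_))
    simp only [Pi.add_apply, add_mul, Complex.add_re]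

lemma FourierNonneg.of_tendsto {ψ : ℕ → ℝ → ℂ} {φ : ℝ → ℂ} (hψ : ∀ n, FourierNonneg (ψ n))
    (hc : ∀ n, Measurable (ψ n)) (hb : ∀ n t, ‖ψ n t‖ ≤ 1)
    (hlim : ∀ t, 0 < t → Tendsto (fun n => ψ n t) atTop (𝓝 (φ t))) : FourierNonneg φ := by
  intro x ε hε
  have h := tendsto_integral_of_dominated_convergence (μ := volume.restrict (Ioi (0 : ℝ)))
    (F := fun n t => (ψ n t * Complex.exp ((x * t : ℝ) * Complex.I)).re * Real.exp (-ε * t ^ 2))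
    (f := fun t => (φ t * Complex.exp ((x * t : ℝ) * Complex.I)).re * Real.exp (-ε * t ^ 2))
    (fun t => Real.exp (-ε * t ^ 2)) (fun n => ?_) (integrableOn_exp_neg_sq hε)
    (fun n => .of_forall fun t => ?_) ?_
  · exact ge_of_tendsto' h fun n => hψ n x ε hε
  · have := hc n
    exact (Measurable.mul (Complex.measurable_re.comp (this.mul (by fun_prop)))
      (by fun_prop)).aestronglyMeasurable
  · rw [norm_mul, Real.norm_of_nonneg (Real.exp_pos _).le, Real.norm_eq_abs]
    exact mul_le_of_le_one_left (Real.exp_pos _).le ((abs_re_mul_exp_le _ _).trans (hb n t))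
  · filter_upwards [ae_restrict_mem measurableSet_Ioi] with t ht
    exact ((Complex.continuous_re.tendsto _).comp ((hlim t ht).mul_const _)).mul_const _

/-- For integrable `φ` the smoothing can be removed, letting `ε = 1 / (n + 1)` tend to `0`. -/
lemma FourierNonneg.integral_nonneg {φ : ℝ → ℂ} (h : FourierNonneg φ)
    (hint : IntegrableOn φ (Ioi 0)) (x : ℝ) :
    0 ≤ ∫ t in Ioi (0 : ℝ), (φ t * Complex.exp ((x * t : ℝ) * Complex.I)).re := by
  have h := tendsto_integral_of_dominated_convergence (μ := volume.restrict (Ioi (0 : ℝ)))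
    (F := fun (n : ℕ) t => (φ t * Complex.exp ((x * t : ℝ) * Complex.I)).re
      * Real.exp (-(1 / ((n : ℝ) + 1)) * t ^ 2))
    (f := fun t => (φ t * Complex.exp ((x * t : ℝ) * Complex.I)).re)
    (fun t => ‖φ t‖) (fun n => ?_) hint.norm
    (fun n => .of_forall fun t => ?_) ?_
  · exact ge_of_tendsto' h fun n => ‹FourierNonneg φ› x _ (by positivity)
  · have h1 : AEStronglyMeasurable (fun t => φ t * Complex.exp ((x * t : ℝ) * Complex.I))
        (volume.restrict (Ioi 0)) := hint.aestronglyMeasurable.mul (by fun_prop)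
    exact (Complex.continuous_re.comp_aestronglyMeasurable h1).mul (by fun_prop)
  · rw [norm_mul, Real.norm_of_nonneg (Real.exp_pos _).le, Real.norm_eq_abs]
    refine (mul_le_of_le_one_right (abs_nonneg _) ?_).trans (abs_re_mul_exp_le _ _)
    rw [Real.exp_le_one_iff, neg_mul, neg_nonpos]
    positivity
  · refine .of_forall fun t => ?_
    have h1 : Tendsto (fun n : ℕ => Real.exp (-(1 / ((n : ℝ) + 1)) * t ^ 2)) atTop (𝓝 1) := by
      have := ((tendsto_one_div_add_atTop_nhds_zero_nat (𝕜 := ℝ)).neg.mul_const (t ^ 2))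
      simpa [Function.comp_def] using (Real.continuous_exp.tendsto _).comp this
    simpa using h1.const_mul ((φ t * Complex.exp ((x * t : ℝ) * Complex.I)).re)

/-- Taylor coefficients of `z + (2 / 3) (1 - z) ^ (3 / 2)`. -/
def genCoeff (k : ℕ) : ℝ :=
  (if k = 1 then 1 else 0) + (2 / 3) * ((-1) ^ k * Ring.choose (3 / 2 : ℝ) k)

lemma choose_succ_eq (a : ℝ) (k : ℕ) :
    Ring.choose a (k + 1) = Ring.choose a k * (a - k) / (k + 1) := by
  rw [eq_div_iff (by positivity)]
  have h1 := Ring.descPochhammer_eq_factorial_smul_choose a k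
  have h2 := Ring.descPochhammer_eq_factorial_smul_choose a (k + 1)
  rw [descPochhammer_succ_right, Polynomial.smeval_mul, h1, Nat.factorial_succ] at h2
  simp [Polynomial.smeval_sub, Polynomial.smeval_natCast] at h2
  have h3 : ((k.factorial : ℕ) : ℝ) ≠ 0 := by positivity
  apply mul_left_cancel₀ h3
  linarith

/-- At index `1` the added `z` cancels the linear term of the power; from index `2` on, successive
coefficients have the positive ratio `(k + 1 / 2) / (k + 3)`. -/
lemma genCoeff_nonneg (k : ℕ) : 0 ≤ genCoeff k := by
  have h2 : ∀ k : ℕ, 0 ≤ (-1) ^ (k + 2) * Ring.choose (3 / 2 : ℝ) (k + 2) := by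
    intro k
    induction k with
    | zero => rw [choose_succ_eq, choose_succ_eq]; norm_num
    | succ k ih =>
      rw [choose_succ_eq, pow_succ]
      have : (-1 : ℝ) ^ (k + 2) * -1 * (Ring.choose (3 / 2 : ℝ) (k + 2) * (3 / 2 - (k + 2 : ℕ)) /
          ((k + 2 : ℕ) + 1)) = ((-1) ^ (k + 2) * Ring.choose (3 / 2 : ℝ) (k + 2)) *
            ((k + 1 / 2) / (k + 3)) := by
        push_cast
        field_simp
        ring
      rw [this]
      positivity
  unfold genCoeff
  match k with
  | 0 => norm_num
  | 1 => rw [choose_succ_eq]; norm_num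
  | k + 2 => have := h2 k; simp only [show k + 2 ≠ 1 by omega, if_false]; linarith

/-- The generating function `z + (2 / 3) (1 - z) ^ (3 / 2)`. -/
def gen (z : ℂ) : ℂ := z + (2 / 3) * (1 - z) ^ (3 / 2 : ℂ)

lemma hasSum_gen {z : ℂ} (hz : ‖z‖ < 1) : HasSum (fun k => (genCoeff k : ℂ) * z ^ k) (gen z) := by
  have h1 := (Complex.one_add_cpow_hasFPowerSeriesOnBall_zero (a := 3 / 2)).hasSum (y := -z)
    (by simpa [← ofReal_norm, ENNReal.ofReal_lt_one] using hz)
  have h2 : HasSum (fun k : ℕ => if k = 1 then z else 0) z := hasSum_ite_eq 1 z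
  have h3 := h2.add (h1.mul_left (2 / 3))
  have hc : ∀ k, Ring.choose (3 / 2 : ℂ) k = ((Ring.choose (3 / 2 : ℝ) k : ℝ) : ℂ) := by
    intro k
    have := Ring.map_choose (Complex.ofRealHom) (3 / 2 : ℝ) k
    simpa using this.symm
  convert! h3 using 1
  · ext k
    simp only [binomialSeries_apply, hc, genCoeff]
    rw [List.ofFn_const, List.prod_replicate, neg_pow z k]
    rcases eq_or_ne k 1 with rfl | hk
    · simp; ring
    · simp [hk]; ring
  · simp [gen, sub_eq_add_neg]

lemma hasSum_gen_ofReal {r : ℝ} (h0 : 0 ≤ r) (h1 : r < 1) :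
    HasSum (fun k => genCoeff k * r ^ k) (r + (2 / 3) * (1 - r) ^ (3 / 2 : ℝ)) := by
  have h := hasSum_gen (z := (r : ℂ)) (by rwa [Complex.norm_of_nonneg h0])
  have h2 : gen r = ((r + (2 / 3) * (1 - r) ^ (3 / 2 : ℝ) : ℝ) : ℂ) := by
    have h3 : ((1 - r) ^ (3 / 2 : ℝ) : ℝ) = ((1 - r : ℂ)) ^ (3 / 2 : ℂ) := by
      rw [Complex.ofReal_cpow (by linarith)]
      push_cast
      rfl
    rw [gen, Complex.ofReal_add, Complex.ofReal_mul, h3]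
    push_cast
    rfl
  rw [h2] at h
  exact_mod_cast h

lemma gen_ofReal_le_one {r : ℝ} (h0 : 0 ≤ r) (h1 : r < 1) :
    r + (2 / 3) * (1 - r) ^ (3 / 2 : ℝ) ≤ 1 := by
  have : (1 - r) ^ (3 / 2 : ℝ) ≤ (1 - r) ^ (1 : ℝ) :=
    Real.rpow_le_rpow_of_exponent_ge (by linarith) (by linarith) (by norm_num)
  rw [Real.rpow_one] at this
  linarith

/-- The characteristic functions of the approximating random walks. -/
def walkCharFun (r σ : ℝ) (N : ℕ) (t : ℝ) : ℂ :=
  (Complex.exp ((σ * t : ℝ) * Complex.I) * gen (r * Complex.exp ((-σ * t : ℝ) * Complex.I))) ^ N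

/-- For `r < 1` the series of `gen` converges, and its truncations yield members of the semiring of
`scaledCharacters`. Their norms are at most `1` because the nonnegative coefficients `genCoeff k * r
^ k` sum to at most `1`. -/
lemma walkCharFun_props {r : ℝ} (h0 : 0 ≤ r) (h1 : r < 1) (σ : ℝ) (N : ℕ) :
    Measurable (walkCharFun r σ N) ∧ (∀ t, ‖walkCharFun r σ N t‖ ≤ 1) ∧
      FourierNonneg (walkCharFun r σ N) := by
  let e : ℝ → ℝ → ℂ := fun y t => Complex.exp ((y * t : ℝ) * Complex.I)
  let ψ : ℕ → ℝ → ℂ := fun m => (e σ * ∑ k ∈ Finset.range m,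
    (fun t => ((genCoeff k * r ^ k : ℝ) : ℂ) * e (-σ * k) t)) ^ N
  have hnorm : ∀ y t, ‖e y t‖ = 1 := fun y t => Complex.norm_exp_ofReal_mul_I _
  have hc : ∀ k, 0 ≤ genCoeff k * r ^ k := fun k => mul_nonneg (genCoeff_nonneg k) (pow_nonneg h0 k)
  have hψ : ∀ m, ψ m ∈ scaledCharacters.subsemiringClosure := by
    intro m
    have hmem : ∀ c y : ℝ, 0 ≤ c →
        (fun t => (c : ℂ) * e y t) ∈ scaledCharacters.subsemiringClosure := fun c y hc => by
      rw [Submonoid.subsemiringClosure_mem]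
      exact AddSubmonoid.subset_closure ⟨c, y, hc, rfl⟩
    refine pow_mem (mul_mem ?_ (sum_mem fun k _ => hmem _ _ (hc k))) N
    simpa using hmem 1 σ zero_le_one
  have hlim : ∀ t, Tendsto (fun m => ψ m t) atTop (𝓝 (walkCharFun r σ N t)) := by
    intro t
    have hz : ‖(r : ℂ) * e (-σ) t‖ < 1 := by
      rwa [norm_mul, hnorm, mul_one, Complex.norm_of_nonneg h0]
    refine ((((hasSum_gen hz).tendsto_sum_nat).const_mul (e σ t)).pow N).congr fun m => ?_
    simp only [ψ, Pi.pow_apply, Pi.mul_apply, Finset.sum_apply]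
    congr 2
    refine Finset.sum_congr rfl fun k _ => ?_
    rw [mul_pow, ← Complex.exp_nat_mul]
    simp only [e]
    push_cast
    ring_nf
  have hle : ∀ m t, ‖ψ m t‖ ≤ 1 := by
    intro m t
    simp only [ψ, Pi.pow_apply, Pi.mul_apply, Finset.sum_apply, norm_pow, norm_mul, hnorm, one_mul]
    refine pow_le_one₀ (norm_nonneg _) ((norm_sum_le _ _).trans ?_)
    refine le_trans ?_ (gen_ofReal_le_one h0 h1)
    refine le_trans (le_of_eq ?_) (sum_le_hasSum (Finset.range m) (fun k _ => hc k)
      (hasSum_gen_ofReal h0 h1))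
    exact Finset.sum_congr rfl fun k _ => by
      rw [norm_mul, hnorm, mul_one, Complex.norm_of_nonneg (hc k)]
  have hmeas : ∀ m, Measurable (ψ m) := fun m =>
    (scaledCharacters_closure_props (hψ m)).1.measurable
  exact ⟨measurable_of_tendsto_metrizable hmeas (tendsto_pi_nhds.2 hlim),
    fun t => le_of_tendsto' (hlim t).norm fun m => hle m t,
    .of_tendsto (fun m => (scaledCharacters_closure_props (hψ m)).2.2) hmeas hle
      fun t _ => hlim t⟩

/-- The principal square root of `2 t i` is `√t (1 + i)`, as its real part is positive. -/
lemma two_mul_I_cpow {t : ℝ} (ht : 0 < t) :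
    (2 / 3 : ℂ) * (2 * t * Complex.I) ^ (3 / 2 : ℂ) = -(expo t) * (1 - Complex.I) := by
  have hne : (2 * t * Complex.I : ℂ) ≠ 0 := by simp [ht.ne']
  have hsq : (2 * t * Complex.I : ℂ) = ((t ^ (1 / 2 : ℝ) : ℝ) * (1 + Complex.I)) ^ 2 := by
    rw [mul_pow, ← Complex.ofReal_pow, ← Real.rpow_natCast, ← Real.rpow_mul ht.le]
    norm_num [add_sq]
    ring
  have hroot : (2 * t * Complex.I : ℂ) ^ (2⁻¹ : ℂ) = (t ^ (1 / 2 : ℝ) : ℝ) * (1 + Complex.I) := by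
    rw [hsq, Complex.sq_cpow_two_inv]
    simpa using Real.rpow_pos_of_pos ht _
  have h1 : t ^ (3 / 2 : ℝ) = t * t ^ (1 / 2 : ℝ) := by
    rw [show (3 / 2 : ℝ) = 1 + 1 / 2 by norm_num, Real.rpow_add ht, Real.rpow_one]
  rw [show (3 / 2 : ℂ) = 1 + 2⁻¹ by norm_num, Complex.cpow_add _ _ hne, Complex.cpow_one, hroot,
    expo, h1]
  push_cast
  linear_combination (4 / 3 * t * (t ^ (1 / 2 : ℝ) : ℝ) : ℂ) * Complex.I_sq

lemma ofReal_mul_cpow {a : ℝ} (ha : 0 < a) {z : ℂ} (hz : z ≠ 0) (p : ℂ) :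
    ((a : ℂ) * z) ^ p = (a : ℂ) ^ p * z ^ p := by
  have ha' : (a : ℂ) ≠ 0 := Complex.ofReal_ne_zero.2 ha.ne'
  rw [Complex.cpow_def_of_ne_zero (mul_ne_zero ha' hz), Complex.cpow_def_of_ne_zero ha',
    Complex.cpow_def_of_ne_zero hz, Complex.log_ofReal_mul ha hz, add_mul, Complex.exp_add,
    Complex.ofReal_log ha.le]

/-- Here `1 - (1 - η ^ 4) / E` equals `η ^ 2 * v` with `v → 2 t i`, so its power `3 / 2` has order
`η ^ 3`, the scale of one step. The damping `η ^ 4`, which keeps the argument of `gen` inside the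
unit disc, is negligible on that scale. -/
lemma tendsto_walk_increment {t : ℝ} (ht : 0 < t) :
    Tendsto (fun η : ℝ => ((η ^ 3)⁻¹ : ℂ) * (Complex.exp ((2 * η ^ 2 * t : ℝ) * Complex.I) *
      gen ((1 - η ^ 4 : ℝ) * Complex.exp ((-(2 * η ^ 2) * t : ℝ) * Complex.I)) - 1)) (𝓝[>] 0)
      (𝓝 (-(expo t) * (1 - Complex.I))) := by
  let E : ℝ → ℂ := fun η => Complex.exp ((2 * η ^ 2 * t : ℝ) * Complex.I)
  let v : ℝ → ℂ := fun η => ((1 : ℂ) - (1 - η ^ 4 : ℝ) * (E η)⁻¹) / (η ^ 2 : ℝ)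
  have hE0 : Tendsto E (𝓝[>] 0) (𝓝 1) := by
    have : Continuous E := by fun_prop
    simpa [E] using (this.tendsto 0).mono_left nhdsWithin_le_nhds
  have hη : Tendsto (fun η : ℝ => (η : ℂ)) (𝓝[>] 0) (𝓝 0) := by
    simpa using (Complex.continuous_ofReal.tendsto 0).mono_left (nhdsWithin_le_nhds (s := Ioi 0))
  have hEinv : Tendsto (fun η => (E η)⁻¹) (𝓝[>] 0) (𝓝 1) := by simpa using hE0.inv₀ one_ne_zero
  have hv : Tendsto v (𝓝[>] 0) (𝓝 (2 * t * Complex.I)) := by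
    have hd : HasDerivAt (fun h : ℝ => -Complex.exp (-(2 * t * Complex.I) * h)) (2 * t * Complex.I)
        0 := by
      have h1 : HasDerivAt (fun h : ℝ => -(2 * t * Complex.I) * (h : ℂ)) (-(2 * t * Complex.I)) 0 := by
        simpa using (Complex.ofRealCLM.hasDerivAt (x := (0 : ℝ))).const_mul (-(2 * t * Complex.I))
      exact h1.cexp.neg.congr_deriv (by simp)
    have hsq : Tendsto (fun η : ℝ => η ^ 2) (𝓝[>] 0) (𝓝[≠] 0) := by
      refine tendsto_nhdsWithin_iff.2 ⟨?_, ?_⟩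
      · simpa using ((continuous_pow 2).tendsto (0 : ℝ)).mono_left (nhdsWithin_le_nhds (s := Ioi 0))
      · filter_upwards [self_mem_nhdsWithin] with η hη
        exact (pow_pos hη 2).ne'
    have h2 := (hasDerivAt_iff_tendsto_slope.1 hd).comp hsq
    have h3 : Tendsto (fun η : ℝ => (η : ℂ) ^ 2 * (E η)⁻¹) (𝓝[>] 0) (𝓝 0) := by
      simpa using (hη.pow 2).mul hEinv
    have h4 := h2.add h3
    rw [add_zero] at h4
    refine h4.congr' ?_
    filter_upwards [self_mem_nhdsWithin] with η hη
    have hη' : (η : ℂ) ≠ 0 := Complex.ofReal_ne_zero.2 (ne_of_gt hη)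
    have h5 : Complex.exp (-(2 * t * Complex.I) * (η ^ 2 : ℝ)) = (E η)⁻¹ := by
      simp only [E]
      rw [← Complex.exp_neg]
      push_cast
      ring_nf
    simp only [Function.comp, slope_def_module, h5, v]
    simp only [Complex.ofReal_zero, mul_zero, Complex.exp_zero, sub_zero, Complex.real_smul]
    push_cast
    field_simp
    ring
  have hv0 : ∀ᶠ η in 𝓝[>] 0, v η ≠ 0 := hv.eventually_ne (by simp [ht.ne'])
  have hcpow : Tendsto (fun η => v η ^ (3 / 2 : ℂ)) (𝓝[>] 0)
      (𝓝 ((2 * t * Complex.I) ^ (3 / 2 : ℂ))) := by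
    refine ((continuousAt_cpow_const ?_).tendsto).comp hv
    exact Or.inr (by simp [ht.ne'])
  have hmain := hη.neg.add ((hE0.mul hcpow).const_mul (2 / 3))
  rw [neg_zero, zero_add, one_mul, two_mul_I_cpow ht] at hmain
  refine hmain.congr' ?_
  filter_upwards [self_mem_nhdsWithin, hv0] with η hη hvη
  have hη0 : (0 : ℝ) < η := hη
  have hη' : (η : ℂ) ≠ 0 := Complex.ofReal_ne_zero.2 hη0.ne'
  have hE : E η ≠ 0 := Complex.exp_ne_zero _
  have hneg : Complex.exp ((-(2 * η ^ 2) * t : ℝ) * Complex.I) = (E η)⁻¹ := by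
    simp only [E]
    rw [← Complex.exp_neg]
    push_cast
    ring_nf
  have hw : (1 : ℂ) - (1 - η ^ 4 : ℝ) * (E η)⁻¹ = (η ^ 2 : ℝ) * v η := by
    simp only [v]
    rw [mul_div_cancel₀]
    exact Complex.ofReal_ne_zero.2 (pow_pos hη0 2).ne'
  have hpow : ((η ^ 2 : ℝ) : ℂ) ^ (3 / 2 : ℂ) = (η : ℂ) ^ 3 := by
    rw [show (3 / 2 : ℂ) = ((3 / 2 : ℝ) : ℂ) by push_cast; rfl, ← Complex.ofReal_cpow (by positivity),
      ← Real.rpow_natCast, ← Real.rpow_mul hη0.le]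
    norm_num
  rw [hneg, gen, hw, ofReal_mul_cpow (pow_pos hη0 2) hvη, hpow]
  change _ = (η ^ 3 : ℂ)⁻¹ * (E η * _ - 1)
  push_cast
  field_simp
  ring

lemma fourierNonneg_stable :
    FourierNonneg fun t => Complex.exp (-(expo t) * (1 - Complex.I)) := by
  -- With this choice `n + 1` increments of order `η ^ 3` add up to order one.
  let η : ℕ → ℝ := fun n => ((n : ℝ) + 1) ^ (-(1 / 3) : ℝ)
  have hη0 : ∀ n, 0 < η n := fun n => by positivity
  have hη1 : ∀ n, η n ≤ 1 := fun n =>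
    Real.rpow_le_one_of_one_le_of_nonpos (by linarith [n.cast_nonneg (α := ℝ)]) (by norm_num)
  have hη3 : ∀ n, (η n ^ 3)⁻¹ = (n : ℝ) + 1 := fun n => by
    rw [← Real.rpow_natCast, ← Real.rpow_mul (by positivity), ← Real.rpow_neg (by positivity)]
    norm_num
  have hlim0 : Tendsto η atTop (𝓝[>] 0) := by
    refine tendsto_nhdsWithin_iff.2 ⟨?_, .of_forall hη0⟩
    exact (tendsto_rpow_neg_atTop (by norm_num)).comp
      (tendsto_atTop_add_const_right _ _ tendsto_natCast_atTop_atTop)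
  have hprops := fun n => walkCharFun_props (r := 1 - η n ^ 4)
    (sub_nonneg.2 (pow_le_one₀ (hη0 n).le (hη1 n))) (sub_lt_self _ (pow_pos (hη0 n) 4))
    (2 * η n ^ 2) (n + 1)
  refine FourierNonneg.of_tendsto (fun n => (hprops n).2.2) (fun n => (hprops n).1)
    (fun n => (hprops n).2.1) fun t ht => ?_
  -- The walk with parameter `η n` has `n + 1` steps, so the `N`-step walk uses `η (N - 1)`.
  let u : ℕ → ℂ := fun N => Complex.exp ((2 * η (N - 1) ^ 2 * t : ℝ) * Complex.I) *
      gen ((1 - η (N - 1) ^ 4 : ℝ) * Complex.exp ((-(2 * η (N - 1) ^ 2) * t : ℝ) * Complex.I)) - 1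
  have h1 : Tendsto (fun N : ℕ => (N : ℂ) * u N) atTop (𝓝 (-(expo t) * (1 - Complex.I))) := by
    rw [← tendsto_add_atTop_iff_nat 1]
    refine ((tendsto_walk_increment ht).comp hlim0).congr fun n => ?_
    simp only [Function.comp, u, Nat.add_sub_cancel]
    congr 1
    have := hη3 n
    rw [← Complex.ofReal_inj] at this
    push_cast at this ⊢
    exact this
  have h2 := (Complex.tendsto_one_add_pow_exp_of_tendsto h1).comp (tendsto_add_atTop_nat 1)
  refine h2.congr fun n => ?_
  simp [u, walkCharFun]

theorem g_nonneg (x : ℝ) : 0 ≤ g x := by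
  have hc := continuous_expo
  have hint : IntegrableOn (fun t => Complex.exp (-(expo t) * (1 - Complex.I))) (Ioi 0) := by
    refine integrableOn_exp_neg_expo.mono' (Continuous.aestronglyMeasurable (by fun_prop))
      (.of_forall fun t => le_of_eq ?_)
    simp [Complex.norm_exp]
  have h := fourierNonneg_stable.integral_nonneg hint x
  rw [g_eq]
  refine mul_nonneg (by positivity) (h.trans_eq (integral_congr_ae (.of_forall fun t => ?_)))
  simp only
  rw [← Complex.exp_add, Complex.exp_re]
  simp [add_comm (expo t)]

theorem g_pos (x : ℝ) : 0 < g x := g_pos_of_nonneg g_nonneg x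

/-! ### The integrals `J k b μ`: measurability, integrability, positivity. -/

/-- The factor `g(μ - a) exp((μ - a)³ / 6)` common to all the integrals `J k b μ`. -/
def tilt (μ a : ℝ) : ℝ := g (μ - a) * Real.exp ((μ - a) ^ 3 / 6)

/-- The integrand of `J k b μ`. -/
def jIntegrand (k : ℕ) (b μ a : ℝ) : ℝ :=
  a ^ (-(k : ℝ) / 2) * tilt μ a * Real.exp (-b ^ 2 / (2 * a))

lemma J_eq (k : ℕ) (b μ : ℝ) : J k b μ = ∫ a in Ioi (0 : ℝ), jIntegrand k b μ a := by
  simp only [J, jIntegrand, tilt, mul_assoc]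

lemma tilt_pos (μ a : ℝ) : 0 < tilt μ a := mul_pos (g_pos _) (Real.exp_pos _)

lemma continuous_tilt : Continuous fun p : ℝ × ℝ => tilt p.1 p.2 := by
  have := continuous_g
  unfold tilt
  fun_prop

lemma measurable_jIntegrand (k : ℕ) :
    Measurable fun p : (ℝ × ℝ) × ℝ => jIntegrand k p.1.1 p.1.2 p.2 := by
  have h0 : Measurable fun x => g x * Real.exp (x ^ 3 / 6) :=
    continuous_g.measurable.mul (by fun_prop)
  have h1 : Measurable fun p : (ℝ × ℝ) × ℝ => p.1.2 - p.2 := by fun_prop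
  have h : Measurable fun p : (ℝ × ℝ) × ℝ => tilt p.1.2 p.2 := h0.comp h1
  have h2 : Measurable fun p : (ℝ × ℝ) × ℝ => p.2 ^ (-(k : ℝ) / 2) := measurable_snd.pow_const _
  have h3 : Measurable fun p : (ℝ × ℝ) × ℝ => Real.exp (-p.1.1 ^ 2 / (2 * p.2)) := by fun_prop
  simp only [jIntegrand]
  exact (h2.mul h).mul h3

lemma measurable_J (k : ℕ) : Measurable fun p : ℝ × ℝ => J k p.1 p.2 := by
  simp only [J_eq]
  exact (StronglyMeasurable.integral_prod_right' (ν := volume.restrict (Ioi 0))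
    (measurable_jIntegrand k).stronglyMeasurable).measurable

lemma measurable_α : Measurable fun p : ℝ × ℝ => α p.1 p.2 := by
  unfold α
  exact Measurable.ite (measurableSet_lt measurable_const measurable_fst)
    ((measurable_J 1).div (measurable_J 3)) measurable_const

lemma jIntegrand_pos (k : ℕ) (b μ : ℝ) {a : ℝ} (ha : 0 < a) : 0 < jIntegrand k b μ a :=
  mul_pos (mul_pos (Real.rpow_pos_of_pos ha _) (tilt_pos _ _)) (Real.exp_pos _)

/-- Since `g` is bounded, only the cubic exponent matters. For `μ - a < -3` it is below `μ - a`;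
otherwise `a ≤ M + 3`, and the constant absorbs everything. -/
lemma exists_tilt_le (M : ℝ) :
    ∃ H, 0 < H ∧ ∀ μ a, |μ| ≤ M → 0 ≤ a → tilt μ a ≤ H * Real.exp (-a) := by
  refine ⟨((1 / Real.pi) * (∫ t in Ioi (0 : ℝ), Real.exp (-expo t)) + 1) *
    Real.exp (M ^ 3 / 6 + 3 + M), ?_, fun μ a hμ ha => ?_⟩
  · have : 0 ≤ ∫ t in Ioi (0 : ℝ), Real.exp (-expo t) :=
      integral_nonneg fun t => (Real.exp_pos _).le
    positivity
  · have hM : 0 ≤ M := (abs_nonneg _).trans hμ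
    have hy : μ - a ≤ M - a := by linarith [le_abs_self μ]
    rw [mul_assoc, ← Real.exp_add]
    refine mul_le_mul ?_ (Real.exp_le_exp.2 ?_) (Real.exp_pos _).le ?_
    · linarith [le_abs_self (g (μ - a)), abs_g_le (μ - a)]
    · set y := μ - a
      have h3 : 0 ≤ M ^ 3 := by positivity
      rcases le_or_gt (-3) y with h | h
      · have : y ^ 3 ≤ M ^ 3 := (Odd.strictMono_pow (by decide)).monotone (by linarith)
        linarith
      · have : y ^ 3 / 6 ≤ y := by nlinarith [mul_pos_of_neg_of_neg (by linarith : y < 0) (by linarith : y + 3 < 0)]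
        linarith
    · linarith [abs_nonneg (g 0), abs_g_le 0]

lemma exists_le_tilt (M A : ℝ) :
    ∃ η, 0 < η ∧ ∀ μ a, |μ| ≤ M → 0 ≤ a → a ≤ A → η ≤ tilt μ a := by
  rcases (Icc (-M) M ×ˢ Icc 0 A).eq_empty_or_nonempty with h | h
  · refine ⟨1, one_pos, fun μ a hμ h0 hA => ?_⟩
    have : (μ, a) ∈ Icc (-M) M ×ˢ Icc 0 A := ⟨abs_le.1 hμ, h0, hA⟩
    simp [h] at this
  · obtain ⟨p, -, hp⟩ := (isCompact_Icc.prod isCompact_Icc).exists_isMinOn h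
      continuous_tilt.continuousOn
    exact ⟨tilt p.1 p.2, tilt_pos _ _, fun μ a hμ h0 hA =>
      isMinOn_iff.1 hp (μ, a) ⟨abs_le.1 hμ, h0, hA⟩⟩

lemma inv_pow_three_mul_exp_le {b a : ℝ} (hb : 0 < b) (ha : 0 < a) :
    a⁻¹ ^ 3 * Real.exp (-b ^ 2 / (2 * a)) ≤ 48 / b ^ 6 := by
  -- The constant is `48 = 3! * 2 ^ 3`.
  have h1 := Real.pow_div_factorial_le_exp (b ^ 2 / (2 * a)) (by positivity) 3
  have h2 : Real.exp (-b ^ 2 / (2 * a)) = (Real.exp (b ^ 2 / (2 * a)))⁻¹ := by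
    rw [← Real.exp_neg, neg_div]
  rw [h2, ← div_eq_mul_inv, div_le_div_iff₀ (Real.exp_pos _) (by positivity)]
  have h3 : (b ^ 2 / (2 * a)) ^ 3 / (Nat.factorial 3 : ℝ) = a⁻¹ ^ 3 * b ^ 6 / 48 := by
    norm_num [Nat.factorial]
    field_simp
    norm_num
  linarith

/-- Near `0` the factor `exp (-b ^ 2 / (2 * a))` absorbs powers up to `a⁻¹ ^ 3`, whence `k ≤ 6`; at
infinity `tilt` decays exponentially. -/
lemma integrableOn_jIntegrand {k : ℕ} (hk : k ≤ 6) {b : ℝ} (hb : 0 < b) (μ : ℝ) :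
    IntegrableOn (jIntegrand k b μ) (Ioi 0) := by
  obtain ⟨H, hH, hle⟩ := exists_tilt_le |μ|
  have hexp : IntegrableOn (fun a : ℝ => (1 + 48 / b ^ 6) * H * Real.exp (-a)) (Ioi 0) :=
    (integrableOn_exp_neg_Ioi 0).const_mul _
  refine hexp.mono' ?_ ?_
  · exact ((measurable_jIntegrand k).comp
      (measurable_const.prodMk measurable_id : Measurable fun a : ℝ => ((b, μ), a))).aestronglyMeasurable
  · filter_upwards [ae_restrict_mem measurableSet_Ioi] with a ha
    have ha' : (0 : ℝ) < a := ha
    rw [Real.norm_of_nonneg (jIntegrand_pos k b μ ha').le, jIntegrand]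
    have h1 : a ^ (-(k : ℝ) / 2) ≤ 1 + a⁻¹ ^ 3 := by
      rw [neg_div, Real.rpow_neg ha'.le, ← Real.inv_rpow ha'.le]
      have hk' : (k : ℝ) ≤ 6 := by exact_mod_cast hk
      rcases le_total a⁻¹ 1 with h | h
      · have := Real.rpow_le_one (inv_pos.2 ha').le h (by positivity : (0 : ℝ) ≤ k / 2)
        have : 0 < a⁻¹ ^ 3 := by positivity
        linarith
      · have := Real.rpow_le_rpow_of_exponent_le h (by linarith : (k : ℝ) / 2 ≤ (3 : ℕ))
        rw [Real.rpow_natCast] at this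
        linarith
    have h2 : Real.exp (-b ^ 2 / (2 * a)) ≤ 1 := by
      rw [Real.exp_le_one_iff, neg_div, neg_nonpos]; positivity
    have h3 := inv_pow_three_mul_exp_le hb ha'
    calc _ ≤ (1 + a⁻¹ ^ 3) * (H * Real.exp (-a)) * Real.exp (-b ^ 2 / (2 * a)) := by
          gcongr
          · exact (tilt_pos _ _).le
          · exact hle μ a le_rfl ha'.le
      _ = (Real.exp (-b ^ 2 / (2 * a)) + a⁻¹ ^ 3 * Real.exp (-b ^ 2 / (2 * a))) *
            (H * Real.exp (-a)) := by ring
      _ ≤ (1 + 48 / b ^ 6) * (H * Real.exp (-a)) := by gcongr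
      _ = _ := by ring

lemma J_pos {k : ℕ} (hk : k ≤ 6) {b : ℝ} (hb : 0 < b) (μ : ℝ) : 0 < J k b μ := by
  rw [J_eq, setIntegral_pos_iff_support_of_nonneg_ae _ (integrableOn_jIntegrand hk hb μ)]
  · have : Function.support (jIntegrand k b μ) ∩ Ioi 0 = Ioi 0 :=
      inter_eq_right.2 fun a (ha : 0 < a) => (jIntegrand_pos k b μ ha).ne'
    simp [this]
  · filter_upwards [ae_restrict_mem measurableSet_Ioi] with a ha
    exact (jIntegrand_pos k b μ ha).le

/-! ### Monotonicity and local Lipschitz continuity of `α` in its first argument. -/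

lemma α_of_pos {b : ℝ} (hb : 0 < b) (μ : ℝ) : α b μ = J 1 b μ / J 3 b μ := if_pos hb

lemma α_of_nonpos {b : ℝ} (hb : b ≤ 0) (μ : ℝ) : α b μ = 0 := if_neg hb.not_gt

lemma α_pos {b : ℝ} (hb : 0 < b) (μ : ℝ) : 0 < α b μ := by
  rw [α_of_pos hb]
  exact div_pos (J_pos (by norm_num) hb μ) (J_pos (by norm_num) hb μ)

lemma α_nonneg (b μ : ℝ) : 0 ≤ α b μ := by
  rcases le_or_gt b 0 with hb | hb
  · rw [α_of_nonpos hb]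
  · exact (α_pos hb μ).le

lemma jIntegrand_one_eq (b μ : ℝ) {a : ℝ} (ha : 0 < a) :
    jIntegrand 1 b μ a = a * jIntegrand 3 b μ a := by
  have : a ^ (-((1 : ℕ) : ℝ) / 2) = a * a ^ (-((3 : ℕ) : ℝ) / 2) := by
    rw [mul_comm, ← Real.rpow_add_one ha.ne']
    norm_num
  rw [jIntegrand, jIntegrand, this]
  ring

lemma jIntegrand_five_eq (b μ : ℝ) {a : ℝ} (ha : 0 < a) :
    jIntegrand 5 b μ a = a⁻¹ * jIntegrand 3 b μ a := by
  have : a ^ (-((5 : ℕ) : ℝ) / 2) = a⁻¹ * a ^ (-((3 : ℕ) : ℝ) / 2) := by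
    rw [mul_comm, ← div_eq_mul_inv, ← Real.rpow_sub_one ha.ne']
    norm_num
  rw [jIntegrand, jIntegrand, this]
  ring

lemma jIntegrand_change (k : ℕ) (b b' μ a : ℝ) :
    jIntegrand k b' μ a = jIntegrand k b μ a * Real.exp (-((b' ^ 2 - b ^ 2) / 2 * a⁻¹)) := by
  rw [jIntegrand, jIntegrand, mul_assoc _ (Real.exp _), ← Real.exp_add]
  congr 2
  rw [div_eq_mul_inv, div_eq_mul_inv, mul_inv]
  ring

/-- `J 1 b' μ - α b μ * J 3 b' μ` as an integral in which both factors that depend on `a - α b μ`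
have the same sign. -/
lemma J_sub_eq {b b' : ℝ} (hb : 0 < b) (hb' : 0 < b') (μ : ℝ) :
    IntegrableOn (fun a => (a - α b μ) * (Real.exp (-((b' ^ 2 - b ^ 2) / 2 * a⁻¹)) -
      Real.exp (-((b' ^ 2 - b ^ 2) / 2 * (α b μ)⁻¹))) * jIntegrand 3 b μ a) (Ioi 0) ∧
    J 1 b' μ - α b μ * J 3 b' μ =
      ∫ a in Ioi (0 : ℝ), (a - α b μ) * (Real.exp (-((b' ^ 2 - b ^ 2) / 2 * a⁻¹)) -
        Real.exp (-((b' ^ 2 - b ^ 2) / 2 * (α b μ)⁻¹))) * jIntegrand 3 b μ a := by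
  set m := α b μ with hm
  set q := Real.exp (-((b' ^ 2 - b ^ 2) / 2 * m⁻¹))
  have i1 := integrableOn_jIntegrand (k := 1) (by norm_num) hb μ
  have i3 := integrableOn_jIntegrand (k := 3) (by norm_num) hb μ
  have i1' := integrableOn_jIntegrand (k := 1) (by norm_num) hb' μ
  have i3' := integrableOn_jIntegrand (k := 3) (by norm_num) hb' μ
  have hA := i1'.sub (i3'.const_mul m)
  -- This combination integrates to zero, since `m = J 1 b μ / J 3 b μ`; that is why the constant
  -- `q` may be subtracted.
  have hB := (i1.sub (i3.const_mul m)).const_mul q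
  have heq : EqOn (fun a => (jIntegrand 1 b' μ a - m * jIntegrand 3 b' μ a) -
      q * (jIntegrand 1 b μ a - m * jIntegrand 3 b μ a))
      (fun a => (a - m) * (Real.exp (-((b' ^ 2 - b ^ 2) / 2 * a⁻¹)) - q) * jIntegrand 3 b μ a)
      (Ioi 0) := by
    intro a ha
    simp only
    rw [jIntegrand_one_eq b μ ha, jIntegrand_one_eq b' μ ha, jIntegrand_change 3 b b']
    ring
  refine ⟨(hA.sub hB).congr_fun heq measurableSet_Ioi, ?_⟩
  rw [← setIntegral_congr_fun measurableSet_Ioi heq]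
  have e1 := integral_sub hA hB
  have e2 := integral_sub i1' (i3'.const_mul m)
  have e3 := integral_sub i1 (i3.const_mul m)
  simp only [Pi.sub_apply] at e1 e2 e3
  have hJ3 := (J_pos (k := 3) (by norm_num) hb μ).ne'
  have h0 : J 1 b μ - m * J 3 b μ = 0 := by rw [hm, α_of_pos hb]; field_simp; ring
  simp only [J_eq] at h0
  rw [e1, integral_const_mul, e2, e3, integral_const_mul, integral_const_mul, h0, J_eq, J_eq]
  ring

/-- Chebyshev's association inequality: passing from `b` to `b'` multiplies the weight by a
nondecreasing function of `a`, which can only raise the mean of `a`. -/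
lemma α_le_α {b b' : ℝ} (hb : 0 < b) (h : b ≤ b') (μ : ℝ) : α b μ ≤ α b' μ := by
  have hb' := hb.trans_le h
  have hm := α_pos hb μ
  rw [α_of_pos hb' μ, le_div_iff₀ (J_pos (by norm_num) hb' μ), ← sub_nonneg, (J_sub_eq hb hb' μ).2]
  refine setIntegral_nonneg measurableSet_Ioi fun a ha => ?_
  have ha' : (0 : ℝ) < a := ha
  have hD : 0 ≤ (b' ^ 2 - b ^ 2) / 2 := by
    have : b ^ 2 ≤ b' ^ 2 := by gcongr
    linarith
  refine mul_nonneg ?_ (jIntegrand_pos 3 b μ ha').le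
  rcases le_total a (α b μ) with h | h
  · refine mul_nonneg_of_nonpos_of_nonpos (sub_nonpos.2 h) (sub_nonpos.2 ?_)
    gcongr
  · refine mul_nonneg (sub_nonneg.2 h) (sub_nonneg.2 ?_)
    gcongr

lemma monotone_α (μ : ℝ) : Monotone fun b => α b μ := by
  intro b b' h
  rcases le_or_gt b 0 with hb | hb
  · simp only [α_of_nonpos hb]
    exact α_nonneg b' μ
  · exact α_le_α hb h μ

lemma abs_exp_neg_sub_exp_neg_le {x y : ℝ} (hx : 0 ≤ x) (hy : 0 ≤ y) :
    |Real.exp (-x) - Real.exp (-y)| ≤ |x - y| := by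
  wlog h : x ≤ y generalizing x y
  · rw [abs_sub_comm, abs_sub_comm x]
    exact this hy hx (le_of_not_ge h)
  · have h1 : Real.exp (-y) = Real.exp (-x) * Real.exp (-(y - x)) := by
      rw [← Real.exp_add]; ring_nf
    have h2 := Real.add_one_le_exp (-(y - x))
    have h3 : Real.exp (-x) ≤ 1 := Real.exp_le_one_iff.2 (by linarith)
    have h4 := Real.exp_pos (-x)
    have h5 : Real.exp (-(y - x)) ≤ 1 := Real.exp_le_one_iff.2 (by linarith)
    rw [abs_of_nonneg (by rw [h1]; nlinarith), abs_of_nonpos (by linarith), h1]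
    nlinarith

/-- With `m = α b μ` and `D = (b' ^ 2 - b ^ 2) / 2`, the integrand of `J_sub_eq` is at most `D * (a
/ m - 2 + m / a)` times the weight. As `J 1 b μ = m * J 3 b μ`, this integrates to `D * (m * J 5 b μ
- J 3 b μ)`, and the negative term is dropped. -/
lemma α_sub_α_le {b b' : ℝ} (hb : 0 < b) (h : b ≤ b') (μ : ℝ) :
    α b' μ - α b μ ≤ (b' ^ 2 - b ^ 2) / 2 * α b μ * J 5 b μ / J 3 b' μ := by
  have hb' := hb.trans_le h
  have hm := α_pos hb μ
  have hJ := J_pos (k := 3) (by norm_num) hb' μ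
  obtain ⟨hint, heq⟩ := J_sub_eq hb hb' μ
  set m := α b μ with hmdef
  rw [α_of_pos hb' μ, div_sub' hJ.ne', div_le_div_iff_of_pos_right hJ, mul_comm (J 3 b' μ), heq]
  set D := (b' ^ 2 - b ^ 2) / 2
  have hD : 0 ≤ D := by
    have : b ^ 2 ≤ b' ^ 2 := by gcongr
    simp only [D]; linarith
  have i1 := integrableOn_jIntegrand (k := 1) (by norm_num) hb μ
  have i3 := integrableOn_jIntegrand (k := 3) (by norm_num) hb μ
  have i5 := integrableOn_jIntegrand (k := 5) (by norm_num) hb μ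
  have hdom := (((i1.const_mul m⁻¹).sub (i3.const_mul 2)).add (i5.const_mul m)).const_mul D
  have hle := setIntegral_mono_on hint hdom measurableSet_Ioi fun a ha => ?_
  · refine hle.trans ?_
    have e1 := integral_add ((i1.const_mul m⁻¹).sub (i3.const_mul 2)) (i5.const_mul m)
    have e2 := integral_sub (i1.const_mul m⁻¹) (i3.const_mul 2)
    simp only [Pi.add_apply, Pi.sub_apply] at e1 e2 ⊢
    rw [integral_const_mul, e1, e2, integral_const_mul, integral_const_mul, integral_const_mul,
      ← J_eq, ← J_eq, ← J_eq]
    have hJ3 := J_pos (k := 3) (by norm_num) hb μ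
    have hJ1 := J_pos (k := 1) (by norm_num) hb μ
    have h0 : m⁻¹ * J 1 b μ = J 3 b μ := by rw [hmdef, α_of_pos hb]; field_simp
    rw [h0, mul_assoc]
    gcongr
    linarith
  · have ha' : (0 : ℝ) < a := ha
    have hw := (jIntegrand_pos 3 b μ ha').le
    simp only [Pi.add_apply, Pi.sub_apply]
    rw [jIntegrand_one_eq b μ ha', jIntegrand_five_eq b μ ha']
    have h1 : (a - m) * (Real.exp (-(D * a⁻¹)) - Real.exp (-(D * m⁻¹))) ≤
        |a - m| * |D * a⁻¹ - D * m⁻¹| := by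
      refine (le_abs_self _).trans ?_
      rw [abs_mul]
      exact mul_le_mul_of_nonneg_left
        (abs_exp_neg_sub_exp_neg_le (by positivity) (by positivity)) (abs_nonneg _)
    have h2 : |a - m| * |D * a⁻¹ - D * m⁻¹| = D * (m⁻¹ * a - 2 + m * a⁻¹) := by
      rw [← abs_mul]
      have : (a - m) * (D * a⁻¹ - D * m⁻¹) = -(D * ((a - m) ^ 2 / (a * m))) := by
        field_simp
        ring
      rw [this, abs_neg, abs_of_nonneg (by positivity)]
      field_simp
      ring
    calc _ ≤ D * (m⁻¹ * a - 2 + m * a⁻¹) * jIntegrand 3 b μ a := by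
          rw [← h2]; exact mul_le_mul_of_nonneg_right h1 hw
      _ = _ := by ring

lemma exists_J_one_le (M : ℝ) : ∃ C, 0 < C ∧ ∀ b μ, 0 < b → |μ| ≤ M → J 1 b μ ≤ C := by
  obtain ⟨H, hH, hle⟩ := exists_tilt_le M
  have hΓ := Real.GammaIntegral_convergent (s := 1 / 2) (by norm_num)
  refine ⟨H * Real.Gamma (1 / 2), mul_pos hH (Real.Gamma_pos_of_pos (by norm_num)),
    fun b μ hb hμ => ?_⟩
  rw [J_eq, Real.Gamma_eq_integral (by norm_num), ← integral_const_mul]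
  refine setIntegral_mono_on (integrableOn_jIntegrand (by norm_num) hb μ) (hΓ.const_mul H)
    measurableSet_Ioi fun a ha => ?_
  have ha' : (0 : ℝ) < a := ha
  have h2 : Real.exp (-b ^ 2 / (2 * a)) ≤ 1 := by
    rw [Real.exp_le_one_iff, neg_div, neg_nonpos]; positivity
  have h3 : a ^ (-((1 : ℕ) : ℝ) / 2) = a ^ (1 / 2 - 1 : ℝ) := by norm_num
  rw [jIntegrand, h3]
  calc _ ≤ a ^ (1 / 2 - 1 : ℝ) * (H * Real.exp (-a)) * 1 := by
        gcongr
        exact hle μ a hμ ha'.le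
    _ = _ := by ring

/-- The range `b ^ 2 < a ≤ 2 * b ^ 2` suffices: there the exponential is at least `exp (-1 / 2)`,
the power has order `b ^ (-3)`, and the length is `b ^ 2`. -/
lemma exists_le_J_three (M B : ℝ) :
    ∃ c, 0 < c ∧ ∀ b μ, 0 < b → b ≤ B → |μ| ≤ M → c / b ≤ J 3 b μ := by
  obtain ⟨η, hη, hle⟩ := exists_le_tilt M (2 * B ^ 2)
  refine ⟨(2 : ℝ) ^ (-(3 / 2) : ℝ) * η * Real.exp (-(1 / 2)), by positivity, fun b μ hb hB hμ => ?_⟩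
  have hb2 : 0 < b ^ 2 := by positivity
  have hsub : Ioc (b ^ 2) (2 * b ^ 2) ⊆ Ioi 0 := fun a ha => hb2.trans ha.1
  have hint := integrableOn_jIntegrand (k := 3) (by norm_num) hb μ
  have h1 : ∫ a in Ioc (b ^ 2) (2 * b ^ 2),
      ((2 * b ^ 2) ^ (-(3 / 2) : ℝ) * η * Real.exp (-(1 / 2))) ≤ J 3 b μ := by
    rw [J_eq]
    refine (setIntegral_mono_on continuous_const.integrableOn_Ioc (hint.mono_set hsub)
      measurableSet_Ioc fun a ha => ?_).trans (setIntegral_mono_set hint ?_ hsub.eventuallyLE)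
    · have ha0 : 0 < a := hb2.trans ha.1
      have h3 : a ^ (-((3 : ℕ) : ℝ) / 2) = a ^ (-(3 / 2) : ℝ) := by norm_num
      rw [jIntegrand, h3]
      refine mul_le_mul (mul_le_mul (Real.rpow_le_rpow_of_nonpos ha0 ha.2 (by norm_num)) ?_ hη.le
        (by positivity)) (Real.exp_le_exp.2 ?_) (Real.exp_pos _).le
        (mul_nonneg (by positivity) (tilt_pos _ _).le)
      · refine hle μ a hμ ha0.le (ha.2.trans ?_)
        gcongr
      · rw [neg_div, neg_le_neg_iff, div_le_div_iff₀ (by positivity) two_pos]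
        linarith [ha.1]
    · filter_upwards [ae_restrict_mem measurableSet_Ioi] with a ha
      exact (jIntegrand_pos 3 b μ ha).le
  refine le_trans (le_of_eq ?_) h1
  have h2 : (b ^ 2) ^ (-(3 / 2) : ℝ) = (b ^ 3)⁻¹ := by
    rw [← Real.rpow_natCast, ← Real.rpow_mul hb.le, ← Real.rpow_natCast, ← Real.rpow_neg hb.le]
    norm_num
  rw [setIntegral_const, Real.mul_rpow two_pos.le hb2.le, h2]
  simp only [Measure.real, Real.volume_Ioc, smul_eq_mul]
  rw [ENNReal.toReal_ofReal (by linarith)]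
  field_simp
  ring

/-- Split at the natural scale `a = b ^ 2`: below it the exponential controls the singularity and
contributes `48`, above it the tail of `a ^ (-5 / 2)` contributes at most `1`. -/
lemma exists_J_five_le (M : ℝ) : ∃ C, 0 < C ∧ ∀ b μ, 0 < b → |μ| ≤ M → J 5 b μ ≤ C / b ^ 3 := by
  obtain ⟨H, hH, hle⟩ := exists_tilt_le M
  refine ⟨H * 49, by positivity, fun b μ hb hμ => ?_⟩
  have hb2 : 0 < b ^ 2 := by positivity
  have hint := integrableOn_jIntegrand (k := 5) (by norm_num) hb μ
  have h5 : ∀ a : ℝ, a ^ (-((5 : ℕ) : ℝ) / 2) = a ^ (-(5 / 2) : ℝ) := fun a => by norm_num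
  have htilt : ∀ a, 0 < a → tilt μ a ≤ H := fun a ha => (hle μ a hμ ha.le).trans
    (mul_le_of_le_one_right hH.le (Real.exp_le_one_iff.2 (by linarith)))
  have hsmall : ∫ a in Ioc 0 (b ^ 2), jIntegrand 5 b μ a ≤ H * (48 / b ^ 3) := by
    have h1 : ∫ a in Ioc 0 (b ^ 2), jIntegrand 5 b μ a ≤
        ∫ a in Ioc 0 (b ^ 2), H * (48 / b ^ 5) := by
      refine setIntegral_mono_on (hint.mono_set Ioc_subset_Ioi_self)
        continuous_const.integrableOn_Ioc measurableSet_Ioc fun a ha => ?_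
      have ha0 : 0 < a := ha.1
      have h2 : a ^ (-(5 / 2) : ℝ) = a ^ (1 / 2 : ℝ) * a⁻¹ ^ 3 := by
        rw [← Real.rpow_natCast, Real.inv_rpow ha0.le, ← Real.rpow_neg ha0.le, ← Real.rpow_add ha0]
        norm_num
      have h3 : a ^ (1 / 2 : ℝ) ≤ b := by
        refine (Real.rpow_le_rpow ha0.le ha.2 (by norm_num)).trans_eq ?_
        rw [← Real.rpow_natCast, ← Real.rpow_mul hb.le]
        norm_num
      rw [jIntegrand, h5, h2]
      calc _ = a ^ (1 / 2 : ℝ) * (a⁻¹ ^ 3 * Real.exp (-b ^ 2 / (2 * a))) * tilt μ a := by ring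
        _ ≤ b * (48 / b ^ 6) * H := by
          gcongr
          · exact (tilt_pos _ _).le
          · exact inv_pow_three_mul_exp_le hb ha0
          · exact htilt a ha0
        _ = _ := by field_simp
    refine h1.trans_eq ?_
    rw [setIntegral_const]
    simp only [Measure.real, Real.volume_Ioc, smul_eq_mul, sub_zero]
    rw [ENNReal.toReal_ofReal hb2.le]
    field_simp
  have hlarge : ∫ a in Ioi (b ^ 2), jIntegrand 5 b μ a ≤ H * (1 / b ^ 3) := by
    have h1 : ∫ a in Ioi (b ^ 2), jIntegrand 5 b μ a ≤
        ∫ a in Ioi (b ^ 2), H * a ^ (-(5 / 2) : ℝ) := by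
      refine setIntegral_mono_on (hint.mono_set (Ioi_subset_Ioi hb2.le))
        ((integrableOn_Ioi_rpow_of_lt (by norm_num) hb2).const_mul H) measurableSet_Ioi
        fun a ha => ?_
      have ha0 : 0 < a := hb2.trans ha
      have h2 : Real.exp (-b ^ 2 / (2 * a)) ≤ 1 := by
        rw [Real.exp_le_one_iff, neg_div, neg_nonpos]; positivity
      rw [jIntegrand, h5]
      calc _ ≤ a ^ (-(5 / 2) : ℝ) * H * 1 := by
            gcongr
            exact htilt a ha0
        _ = _ := by ring
    refine h1.trans ?_
    rw [integral_const_mul, integral_Ioi_rpow_of_lt (by norm_num) hb2]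
    have h2 : (b ^ 2) ^ (-(5 / 2) + 1 : ℝ) = (b ^ 3)⁻¹ := by
      rw [← Real.rpow_natCast, ← Real.rpow_mul hb.le, ← Real.rpow_natCast, ← Real.rpow_neg hb.le]
      norm_num
    rw [h2]
    have : 0 < (b ^ 3)⁻¹ := by positivity
    refine mul_le_mul_of_nonneg_left ?_ hH.le
    rw [one_div, neg_div, div_eq_mul_inv]
    norm_num
    linarith
  rw [J_eq, ← Ioc_union_Ioi_eq_Ioi hb2.le, setIntegral_union Ioc_disjoint_Ioi_same measurableSet_Ioi
    (hint.mono_set Ioc_subset_Ioi_self) (hint.mono_set (Ioi_subset_Ioi hb2.le))]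
  refine (add_le_add hsmall hlarge).trans_eq ?_
  ring

/-- The drift correction is Lipschitz in its first argument, locally uniformly. -/
theorem exists_lipschitz_α (M B : ℝ) : ∃ L, 0 ≤ L ∧ ∀ b b' μ, 0 ≤ b → b ≤ b' → b' ≤ B → |μ| ≤ M →
    α b' μ - α b μ ≤ L * (b' - b) := by
  obtain ⟨C₁, hC₁, h1⟩ := exists_J_one_le M
  obtain ⟨c, hc, h3⟩ := exists_le_J_three M B
  obtain ⟨C₅, hC₅, h5⟩ := exists_J_five_le M
  have hlin : ∀ b μ, 0 < b → b ≤ B → |μ| ≤ M → α b μ ≤ C₁ / c * b := by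
    intro b μ hb hB hμ
    rw [α_of_pos hb, div_le_iff₀ (J_pos (by norm_num) hb μ)]
    refine (h1 b μ hb hμ).trans ?_
    have := mul_le_mul_of_nonneg_left (h3 b μ hb hB hμ) (by positivity : 0 ≤ C₁ / c * b)
    refine le_trans (le_of_eq ?_) this
    field_simp
  refine ⟨2 * (C₁ / c) + 3 * (C₁ * C₅ / c ^ 2), by positivity, fun b b' μ hb hbb hB hμ => ?_⟩
  have hd : 0 ≤ b' - b := sub_nonneg.2 hbb
  have p1 : 0 ≤ C₁ / c := by positivity
  have p2 : 0 ≤ C₁ * C₅ / c ^ 2 := by positivity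
  rcases hbb.eq_or_lt with rfl | hlt
  · simp
  have hb' : 0 < b' := hb.trans_lt hlt
  -- If `b' ≥ 2 * b` (in particular if `b = 0`), then `b' ≤ 2 * (b' - b)` and the linear bound is
  -- enough. Otherwise `b` and `b'` are comparable and the powers of `b` in `α_sub_α_le` cancel.
  rcases le_or_gt (2 * b) b' with h | h
  · have := hlin b' μ hb' hB hμ
    have := α_nonneg b μ
    have h4 : C₁ / c * b' ≤ C₁ / c * (2 * (b' - b)) := by gcongr; linarith
    have := mul_nonneg p2 hd
    linarith
  · have hb0 : 0 < b := by linarith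
    have hJ3 := J_pos (k := 3) (by norm_num) hb' μ
    refine (α_sub_α_le hb0 hbb μ).trans ?_
    have h6 : (b' ^ 2 - b ^ 2) / 2 * α b μ * J 5 b μ / J 3 b' μ ≤
        (b' ^ 2 - b ^ 2) / 2 * (C₁ / c * b) * (C₅ / b ^ 3) / (c / b') := by
      have : 0 ≤ (b' ^ 2 - b ^ 2) / 2 := by nlinarith
      gcongr
      · exact (J_pos (by norm_num) hb0 μ).le
      · exact hlin b μ hb0 (hbb.trans hB) hμ
      · exact h5 b μ hb0 hμ
      · exact h3 b' μ hb' hB hμ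
    have h7 : (b' ^ 2 - b ^ 2) / 2 * (C₁ / c * b) * (C₅ / b ^ 3) / (c / b') =
        (C₁ * C₅ / c ^ 2) * (b' - b) * (((b' + b) * b') / (2 * b ^ 2)) := by
      field_simp
      ring
    have h8 : ((b' + b) * b') / (2 * b ^ 2) ≤ 3 := by
      rw [div_le_iff₀ (by positivity)]
      nlinarith
    have h9 : (C₁ * C₅ / c ^ 2) * (b' - b) * (((b' + b) * b') / (2 * b ^ 2)) ≤
        (C₁ * C₅ / c ^ 2) * (b' - b) * 3 := by gcongr
    have := mul_nonneg p1 hd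
    linarith

/-! ### Comparison and uniqueness for deterministic reflected paths. -/

lemma stieltjesFunction_apply_of_continuous {k : ℝ≥0 → ℝ} (hk : Monotone k) (hc : Continuous k)
    (t : ℝ≥0) : hk.stieltjesFunction t = k t := by
  rw [hk.stieltjesFunction_eq]
  exact hc.continuousAt.continuousWithinAt.rightLim_eq

namespace IsReflectedPath

variable {lam : ℝ} {w z k w' z' k' : ℝ≥0 → ℝ}

/-- The measure `dk` does not charge `{z > 0}`, so it gives `(s, t]` mass zero. -/
lemma k_eq_of_pos (h : IsReflectedPath lam w z k) {s t : ℝ≥0} (hst : s ≤ t)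
    (hz : ∀ r, s < r → r ≤ t → 0 < z r) : k s = k t := by
  have h1 := (lintegral_eq_zero_iff (h.z_cont.measurable.ennreal_ofReal)).1 h.reflect
  have h2 : h.k_mono.stieltjesFunction.measure (Ioc s t) = 0 := by
    refine measure_mono_null (fun r hr => ?_) h1
    simpa using hz r hr.1 hr.2
  rw [StieltjesFunction.measure_Ioc, ENNReal.ofReal_eq_zero,
    stieltjesFunction_apply_of_continuous _ h.k_cont,
    stieltjesFunction_apply_of_continuous _ h.k_cont] at h2
  linarith [h.k_mono hst]

/-- Since the drift is nonincreasing in space, the solution depends on the driving path in a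
Lipschitz way. -/
lemma sub_le (h : IsReflectedPath lam w z k) (h' : IsReflectedPath lam w' z' k') {T : ℝ≥0} {δ : ℝ}
    (hw : ∀ s ≤ T, |w s - w' s| ≤ δ) : z T - z' T ≤ 2 * δ := by
  -- Let `t₀` be the last such time. After it `z > z' ≥ 0`, so `k` is frozen, `k'` only helps, and
  -- the drift of `z` is at most that of `z'`. Only the increment of `w - w'` over `[t₀, T]`
  -- remains, which costs `2 * δ`.
  let S : Set ℝ≥0 := {s | s ≤ T ∧ z s ≤ z' s}
  have hS : IsCompact S := (isCompact_Icc (a := 0) (b := T)).of_isClosed_subset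
    (isClosed_Iic.inter (isClosed_le h.z_cont h'.z_cont)) fun s hs => ⟨zero_le, hs.1⟩
  have h0 : (0 : ℝ≥0) ∈ S := ⟨zero_le, by rw [h.z_zero, h'.z_zero]⟩
  obtain ⟨t₀, ht₀, hmax⟩ := hS.exists_isGreatest ⟨0, h0⟩
  have hgt : ∀ s, t₀ < s → s ≤ T → z' s < z s := fun s hs hsT => by
    by_contra hle
    exact absurd (hmax (show s ∈ S from ⟨hsT, not_lt.1 hle⟩)) (not_le.2 hs)
  have hk := h.k_eq_of_pos ht₀.1 fun r h1 h2 => (h'.z_nonneg r).trans_lt (hgt r h1 h2)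
  have hk' := h'.k_mono ht₀.1
  have e1 := h.equation T
  have e2 := h.equation t₀
  have e1' := h'.equation T
  have e2' := h'.equation t₀
  have i1 := intervalIntegral.integral_interval_sub_left (h.drift_integrable T)
    (h.drift_integrable t₀)
  have i2 := intervalIntegral.integral_interval_sub_left (h'.drift_integrable T)
    (h'.drift_integrable t₀)
  have hd : ∫ s in (t₀ : ℝ)..T, drift lam s (z s.toNNReal) ≤
      ∫ s in (t₀ : ℝ)..T, drift lam s (z' s.toNNReal) := by
    refine intervalIntegral.integral_mono_on_of_le_Ioo (by exact_mod_cast ht₀.1)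
      ((h.drift_integrable t₀).symm.trans (h.drift_integrable T))
      ((h'.drift_integrable t₀).symm.trans (h'.drift_integrable T)) fun s hs => ?_
    have h1 : t₀ < s.toNNReal := Real.lt_toNNReal_iff_coe_lt.2 hs.1
    have h2 : s.toNNReal ≤ T := Real.toNNReal_le_iff_le_coe.2 hs.2.le
    have := monotone_α (lam - s) (hgt _ h1 h2).le
    simp only [drift]
    linarith
  have a1 := abs_le.1 (hw T le_rfl)
  have a2 := abs_le.1 (hw t₀ ht₀.1)
  linarith [ht₀.2, a1.2, a2.1]

lemma abs_sub_le (h : IsReflectedPath lam w z k) (h' : IsReflectedPath lam w' z' k') {T : ℝ≥0}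
    {δ : ℝ} (hw : ∀ s ≤ T, |w s - w' s| ≤ δ) : |z T - z' T| ≤ 2 * δ :=
  abs_sub_le_iff.2 ⟨h.sub_le h' hw, h'.sub_le h fun s hs => by rw [abs_sub_comm]; exact hw s hs⟩

lemma unique (h : IsReflectedPath lam w z k) (h' : IsReflectedPath lam w z' k') :
    z = z' ∧ k = k' := by
  have hz : z = z' := by
    ext t
    have := h.abs_sub_le h' (T := t) (δ := 0) fun s _ => by simp
    rw [mul_zero] at this
    exact sub_eq_zero.1 (abs_nonpos_iff.1 this)
  subst hz
  refine ⟨rfl, funext fun t => ?_⟩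
  have e1 := h.equation t
  have e2 := h'.equation t
  linarith

lemma w_zero (h : IsReflectedPath lam w z k) : w 0 = 0 := by
  have := h.equation 0
  simp only [h.z_zero, h.k_zero, NNReal.coe_zero, intervalIntegral.integral_same] at this
  linarith

end IsReflectedPath

/-! ### The Skorokhod reflection map. -/

/-- The running maximum of `-x`. -/
def runSup (x : ℝ≥0 → ℝ) (t : ℝ≥0) : ℝ := sSup ((fun u : ℝ≥0 => -x (u * t)) '' Icc 0 1)

section runSup

variable {x y : ℝ≥0 → ℝ}

/-- Rescaling time makes the supremum run over the fixed compact interval `[0, 1]`, so joint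
continuity suffices. -/
lemma continuous_runSup (hx : Continuous x) : Continuous (runSup x) :=
  isCompact_Icc.continuous_sSup (f := fun t u : ℝ≥0 => -x (u * t))
    (by simp only [Function.HasUncurry.uncurry, id]; fun_prop)

lemma exists_runSup_eq (hx : Continuous x) (t : ℝ≥0) : ∃ s ≤ t, runSup x t = -x s := by
  obtain ⟨u, hu, h⟩ := (isCompact_Icc (a := (0 : ℝ≥0)) (b := 1)).exists_sSup_image_eq
    ⟨0, by simp⟩ (f := fun u : ℝ≥0 => -x (u * t)) (by fun_prop)
  exact ⟨u * t, mul_le_of_le_one_left zero_le hu.2, h⟩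

lemma neg_le_runSup (hx : Continuous x) {s t : ℝ≥0} (hst : s ≤ t) : -x s ≤ runSup x t := by
  have hbdd : BddAbove ((fun u : ℝ≥0 => -x (u * t)) '' Icc 0 1) :=
    (isCompact_Icc.image (by fun_prop)).bddAbove
  refine le_csSup hbdd ⟨s / t, ⟨zero_le, div_le_one_of_le₀ hst zero_le⟩, ?_⟩
  rcases eq_or_ne t 0 with rfl | ht
  · simp [le_antisymm hst zero_le]
  · simp [div_mul_cancel₀ s ht]

lemma monotone_runSup (hx : Continuous x) : Monotone (runSup x) := by
  intro s t hst
  obtain ⟨r, hr, h⟩ := exists_runSup_eq hx s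
  rw [h]
  exact neg_le_runSup hx (hr.trans hst)

lemma runSup_zero (x : ℝ≥0 → ℝ) : runSup x 0 = -x 0 := by
  simp [runSup]

lemma add_runSup_nonneg (hx : Continuous x) (t : ℝ≥0) : 0 ≤ x t + runSup x t := by
  linarith [neg_le_runSup hx (le_refl t)]

lemma runSup_sub_le (hx : Continuous x) (hy : Continuous y) {t : ℝ≥0} {δ : ℝ}
    (h : ∀ s ≤ t, |x s - y s| ≤ δ) : runSup x t - runSup y t ≤ δ := by
  obtain ⟨s, hs, h1⟩ := exists_runSup_eq hx t
  linarith [neg_le_runSup hy hs, (abs_le.1 (h s hs)).1]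

lemma abs_add_runSup_sub_le (hx : Continuous x) (hy : Continuous y) {t : ℝ≥0} {δ : ℝ}
    (h : ∀ s ≤ t, |x s - y s| ≤ δ) : |(x t + runSup x t) - (y t + runSup y t)| ≤ 2 * δ := by
  have h1 := runSup_sub_le hx hy h
  have h2 := runSup_sub_le hy hx fun s hs => by rw [abs_sub_comm]; exact h s hs
  have h3 := abs_le.1 (h t le_rfl)
  exact abs_le.2 ⟨by linarith [h3.1], by linarith [h3.2]⟩

/-- While the reflected path is positive the running maximum sets no new record, so it is locally
constant there. -/
lemma lintegral_add_runSup (hx : Continuous x) (hm : Monotone (runSup x)) :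
    ∫⁻ t, ENNReal.ofReal (x t + runSup x t) ∂hm.stieltjesFunction.measure = 0 := by
  have hc := continuous_runSup hx
  rw [lintegral_eq_zero_iff (by fun_prop)]
  refine measure_null_of_locally_null _ fun t ht => ?_
  have ht' : 0 < x t + runSup x t := by simpa using ht
  have ht0 : 0 < t := by
    refine pos_iff_ne_zero.2 ?_
    rintro rfl
    simp [runSup_zero] at ht'
  have hev : ∀ᶠ p : ℝ≥0 × ℝ≥0 in 𝓝 t ×ˢ 𝓝 t, 0 < x p.1 + runSup x p.2 := by
    rw [← nhds_prod_eq]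
    exact continuousAt_const.eventually_lt
      (Continuous.continuousAt (by fun_prop)) ht'
  obtain ⟨U, hU, hUU⟩ := eventually_prod_self_iff (r := fun r s => 0 < x r + runSup x s).1 hev
  obtain ⟨l, u, htlu, hsub⟩ := (mem_nhds_iff_exists_Ioo_subset' ⟨0, ht0⟩ ⟨t + 1, by simp⟩).1 hU
  obtain ⟨a, hla, hat⟩ := exists_between htlu.1
  obtain ⟨b, htb, hbu⟩ := exists_between htlu.2
  refine ⟨Ioc a b, mem_nhdsWithin_of_mem_nhds (Ioc_mem_nhds hat htb), ?_⟩
  rw [StieltjesFunction.measure_Ioc, ENNReal.ofReal_eq_zero, stieltjesFunction_apply_of_continuous _ hc,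
    stieltjesFunction_apply_of_continuous _ hc, sub_nonpos]
  -- If the maximum up to `b` were attained after `a`, then `x s + runSup x a > 0` would place `-x
  -- s` strictly below `runSup x a`, a contradiction.
  obtain ⟨s, hs, h1⟩ := exists_runSup_eq hx b
  rcases le_or_gt s a with h2 | h2
  · rw [h1]
    exact neg_le_runSup hx h2
  · have h3 := hUU s (hsub ⟨hla.trans h2, hs.trans_lt hbu⟩) a (hsub ⟨hla, hat.trans htlu.2⟩)
    have h4 := monotone_runSup hx (hat.trans htb).le
    linarith

end runSup

/-! ### Existence for a continuous driving path, by Picard iteration. -/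

section existence

variable {lam : ℝ} {w z z' : ℝ≥0 → ℝ}

lemma measurable_drift (lam : ℝ) (hz : Continuous z) :
    Measurable fun s : ℝ => drift lam s (z s.toNNReal) := by
  have h1 : Measurable fun s : ℝ => (z s.toNNReal, lam - s) := by
    have : Continuous fun s : ℝ => (z s.toNNReal, lam - s) := by fun_prop
    exact this.measurable
  have h2 : Measurable fun s : ℝ => α (z s.toNNReal) (lam - s) := measurable_α.comp h1
  exact (measurable_const.sub measurable_id).sub h2

/-- As `α` vanishes at `0`, its Lipschitz bound makes it bounded along a path that is bounded on the
interval. -/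
lemma intervalIntegrable_drift (lam : ℝ) (hz : Continuous z) (hz0 : ∀ t, 0 ≤ z t) (a b : ℝ) :
    IntervalIntegrable (fun s : ℝ => drift lam s (z s.toNNReal)) volume a b := by
  have hc : Continuous fun s : ℝ => z s.toNNReal := by fun_prop
  obtain ⟨B, hB⟩ := (isCompact_uIcc (a := a) (b := b)).bddAbove_image hc.continuousOn
  obtain ⟨L, hL₀, hL⟩ := exists_lipschitz_α (|lam| + (|a| + |b|)) B
  have hs : ∀ s ∈ uIcc a b, |s| ≤ |a| + |b| := fun s hs => by
    rcases mem_uIcc.1 hs with h | h <;>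
      exact abs_le.2 ⟨by linarith [neg_abs_le a, neg_abs_le b, abs_nonneg a, abs_nonneg b],
        by linarith [le_abs_self a, le_abs_self b, abs_nonneg a, abs_nonneg b]⟩
  refine intervalIntegrable_const (c := |lam| + (|a| + |b|) + L * B) |>.mono_fun'
    (measurable_drift lam hz).aestronglyMeasurable ?_
  filter_upwards [ae_restrict_mem measurableSet_uIoc] with s hsab
  have hsm := hs s (uIoc_subset_uIcc hsab)
  have hμ : |lam - s| ≤ |lam| + (|a| + |b|) := (abs_sub _ _).trans (by linarith)
  have hzB : z s.toNNReal ≤ B := hB (mem_image_of_mem _ (uIoc_subset_uIcc hsab))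
  have h1 := hL 0 (z s.toNNReal) (lam - s) le_rfl (hz0 _) hzB hμ
  rw [α_of_nonpos le_rfl, sub_zero, sub_zero] at h1
  have h2 := α_nonneg (z s.toNNReal) (lam - s)
  have hL0 : L * z s.toNNReal ≤ L * B := by gcongr
  rw [drift, Real.norm_eq_abs]
  refine (abs_sub _ _).trans (add_le_add hμ ?_)
  rw [abs_of_nonneg h2]
  exact h1.trans hL0

/-- The unreflected path driven by `w` along the drift of `z`. -/
def driven (lam : ℝ) (w z : ℝ≥0 → ℝ) (t : ℝ≥0) : ℝ :=
  w t + ∫ s in (0 : ℝ)..t, drift lam s (z s.toNNReal)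

lemma continuous_driven (hw : Continuous w) (hz : Continuous z) (hz0 : ∀ t, 0 ≤ z t) :
    Continuous (driven lam w z) :=
  hw.add ((intervalIntegral.continuous_primitive
    (fun a b => intervalIntegrable_drift lam hz hz0 a b) 0).comp NNReal.continuous_coe)

lemma driven_zero (lam : ℝ) (w z : ℝ≥0 → ℝ) : driven lam w z 0 = w 0 := by simp [driven]

/-- One step of the Picard iteration: the reflection of the path driven along the drift of `z`. -/
def picardStep (lam : ℝ) (w z : ℝ≥0 → ℝ) (t : ℝ≥0) : ℝ :=
  driven lam w z t + runSup (driven lam w z) t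

lemma continuous_picardStep (hw : Continuous w) (hz : Continuous z) (hz0 : ∀ t, 0 ≤ z t) :
    Continuous (picardStep lam w z) :=
  (continuous_driven hw hz hz0).add (continuous_runSup (continuous_driven hw hz hz0))

lemma picardStep_nonneg (hw : Continuous w) (hz : Continuous z) (hz0 : ∀ t, 0 ≤ z t) (t : ℝ≥0) :
    0 ≤ picardStep lam w z t :=
  add_runSup_nonneg (continuous_driven hw hz hz0) t

/-- The reflected value is an increment of the driven path, whose drift is at most `|lam|` because
`α ≥ 0`. The bound does not depend on `z`, so one Lipschitz constant serves all iterates. -/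
lemma picardStep_le (hw : Continuous w) (hz : Continuous z) (hz0 : ∀ t, 0 ≤ z t) {T : ℝ≥0} {C : ℝ}
    (hC : ∀ s ≤ T, |w s| ≤ C) {t : ℝ≥0} (ht : t ≤ T) :
    picardStep lam w z t ≤ 2 * C + |lam| * T := by
  obtain ⟨s, hs, h⟩ := exists_runSup_eq (continuous_driven (lam := lam) hw hz hz0) t
  have i1 := intervalIntegral.integral_interval_sub_left
    (intervalIntegrable_drift lam hz hz0 0 t) (intervalIntegrable_drift lam hz hz0 0 s)
  have hst : (s : ℝ) ≤ t := by exact_mod_cast hs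
  have h1 : ∫ r in (s : ℝ)..t, drift lam r (z r.toNNReal) ≤ ∫ r in (s : ℝ)..t, |lam| := by
    refine intervalIntegral.integral_mono_on hst (intervalIntegrable_drift lam hz hz0 s t)
      intervalIntegrable_const fun r hr => ?_
    have := α_nonneg (z r.toNNReal) (lam - r)
    have : (0 : ℝ) ≤ r := s.coe_nonneg.trans hr.1
    simp only [drift]
    linarith [le_abs_self lam]
  rw [intervalIntegral.integral_const, smul_eq_mul] at h1
  have h2 : ((t : ℝ) - s) * |lam| ≤ |lam| * T := by
    rw [mul_comm]
    have : (t : ℝ) ≤ T := by exact_mod_cast ht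
    gcongr
    linarith [s.coe_nonneg]
  have h3 := abs_le.1 (hC t ht)
  have h4 := abs_le.1 (hC s (hs.trans ht))
  rw [picardStep, h, driven, driven]
  linarith [h3.2, h4.1]

/-- In a suitable weighted uniform norm the Picard step is a contraction. -/
lemma picardStep_sub_le (hw : Continuous w) (hz : Continuous z) (hz0 : ∀ t, 0 ≤ z t)
    (hz' : Continuous z') (hz0' : ∀ t, 0 ≤ z' t) {T : ℝ≥0} {B L c : ℝ} (hLpos : 0 < L) (hc : 0 ≤ c)
    (hL : ∀ b b' μ, 0 ≤ b → b ≤ b' → b' ≤ B → |μ| ≤ |lam| + T → α b' μ - α b μ ≤ L * (b' - b))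
    (hB : ∀ s ≤ T, z s ≤ B) (hB' : ∀ s ≤ T, z' s ≤ B)
    (h : ∀ s ≤ T, |z s - z' s| ≤ c * Real.exp (4 * L * s)) {t : ℝ≥0} (ht : t ≤ T) :
    |picardStep lam w z t - picardStep lam w z' t| ≤ c / 2 * Real.exp (4 * L * t) := by
  -- Integrating `L * exp (4 * L * r)` gains a factor `1 / 4`; reflection loses a factor `2`,
  -- leaving the contraction factor `1 / 2`.
  have key : ∀ s ≤ t, |driven lam w z s - driven lam w z' s| ≤ c / 4 * Real.exp (4 * L * t) := by
    intro s hs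
    have hαabs : ∀ b b' μ, 0 ≤ b → 0 ≤ b' → b ≤ B → b' ≤ B → |μ| ≤ |lam| + T →
        |α b μ - α b' μ| ≤ L * |b - b'| := by
      intro b b' μ h1 h2 h3 h4 h5
      rcases le_total b b' with h | h
      · rw [abs_sub_comm, abs_sub_comm b,
          abs_of_nonneg (sub_nonneg.2 (monotone_α μ h)), abs_of_nonneg (sub_nonneg.2 h)]
        exact hL b b' μ h1 h h4 h5
      · rw [abs_of_nonneg (sub_nonneg.2 (monotone_α μ h)), abs_of_nonneg (sub_nonneg.2 h)]
        exact hL b' b μ h2 h h3 h5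
    have e : driven lam w z s - driven lam w z' s =
        ∫ r in (0 : ℝ)..s, (drift lam r (z r.toNNReal) - drift lam r (z' r.toNNReal)) := by
      rw [intervalIntegral.integral_sub (intervalIntegrable_drift lam hz hz0 0 s)
        (intervalIntegrable_drift lam hz' hz0' 0 s), driven, driven]
      ring
    have hint : IntervalIntegrable (fun r : ℝ => c * L * Real.exp (4 * L * r)) volume 0 s :=
      Continuous.intervalIntegrable (by fun_prop) _ _
    have hle := intervalIntegral.norm_integral_le_of_norm_le (μ := volume) s.coe_nonneg
      (f := fun r => drift lam r (z r.toNNReal) - drift lam r (z' r.toNNReal))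
      (.of_forall fun r hr => ?_) hint
    · rw [e, ← Real.norm_eq_abs]
      refine hle.trans ?_
      have hd : ∀ r : ℝ, HasDerivAt (fun r => c / 4 * Real.exp (4 * L * r))
          (c * L * Real.exp (4 * L * r)) r := fun r =>
        (((hasDerivAt_id r).const_mul (4 * L)).exp.const_mul (c / 4)).congr_deriv (by
          simp only [id]; ring)
      rw [intervalIntegral.integral_eq_sub_of_hasDerivAt (fun r _ => hd r) hint]
      have h1 : Real.exp (4 * L * s) ≤ Real.exp (4 * L * t) := by
        have : (s : ℝ) ≤ t := by exact_mod_cast hs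
        gcongr
      have h2 : c / 4 * Real.exp (4 * L * s) ≤ c / 4 * Real.exp (4 * L * t) := by gcongr
      have h3 : 0 ≤ c / 4 * Real.exp (4 * L * 0) := by positivity
      linarith
    · have hrT : r.toNNReal ≤ T := (Real.toNNReal_le_iff_le_coe.2 hr.2).trans (hs.trans ht)
      have hrT' : r ≤ T := Real.toNNReal_le_iff_le_coe.1 hrT
      have hμ : |lam - r| ≤ |lam| + T :=
        (abs_sub _ _).trans (by rw [abs_of_pos hr.1]; linarith)
      have h1 := hαabs (z r.toNNReal) (z' r.toNNReal) (lam - r) (hz0 _) (hz0' _) (hB _ hrT)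
        (hB' _ hrT) hμ
      have h2 := h _ hrT
      rw [Real.coe_toNNReal r hr.1.le] at h2
      have e2 : drift lam r (z r.toNNReal) - drift lam r (z' r.toNNReal) =
        -(α (z r.toNNReal) (lam - r) - α (z' r.toNNReal) (lam - r)) := by simp only [drift]; ring
      rw [e2, norm_neg, Real.norm_eq_abs]
      calc _ ≤ L * (c * Real.exp (4 * L * r)) := h1.trans (by gcongr)
        _ = _ := by ring
  refine (abs_add_runSup_sub_le (continuous_driven hw hz hz0) (continuous_driven hw hz' hz0')
    key).trans_eq ?_
  ring

/-- The Picard iterates, started from the zero path. -/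
def picardIter (lam : ℝ) (w : ℝ≥0 → ℝ) : ℕ → ℝ≥0 → ℝ
  | 0 => 0
  | n + 1 => picardStep lam w (picardIter lam w n)

lemma picardIter_props (hw : Continuous w) (n : ℕ) :
    Continuous (picardIter lam w n) ∧ ∀ t, 0 ≤ picardIter lam w n t := by
  induction n with
  | zero => exact ⟨continuous_const, fun _ => le_rfl⟩
  | succ n ih => exact ⟨continuous_picardStep hw ih.1 ih.2, picardStep_nonneg hw ih.1 ih.2⟩

/-- The deterministic reflected equation is solvable for every continuous driving path. -/
theorem exists_isReflectedPath (lam : ℝ) (hw : Continuous w) (hw0 : w 0 = 0) :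
    ∃ z k, IsReflectedPath lam w z k := by
  have hc := fun n => (picardIter_props (lam := lam) hw n).1
  have hn := fun n => (picardIter_props (lam := lam) hw n).2
  have hbound : ∀ T : ℝ≥0, ∃ B L : ℝ, 0 ≤ B ∧ 0 < L ∧
      (∀ b b' μ, 0 ≤ b → b ≤ b' → b' ≤ B → |μ| ≤ |lam| + T → α b' μ - α b μ ≤ L * (b' - b)) ∧
      ∀ n, ∀ s ≤ T, picardIter lam w n s ≤ B := by
    intro T
    obtain ⟨C, hC⟩ := (isCompact_Icc (a := 0) (b := T)).exists_bound_of_continuousOn hw.continuousOn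
    have hC' : ∀ s ≤ T, |w s| ≤ C := fun s hs => hC s ⟨zero_le, hs⟩
    have hC0 : 0 ≤ C := (abs_nonneg _).trans (hC' 0 zero_le)
    obtain ⟨L, hL0, hL⟩ := exists_lipschitz_α (|lam| + T) (2 * C + |lam| * T)
    -- `L + 1` replaces `L` because the contraction estimate needs a strictly positive constant.
    refine ⟨2 * C + |lam| * T, L + 1, by positivity, by linarith,
      fun b b' μ h1 h2 h3 h4 => (hL b b' μ h1 h2 h3 h4).trans (by nlinarith), fun n s hs => ?_⟩
    cases n with
    | zero => exact le_trans (le_of_eq rfl) (by positivity : 0 ≤ 2 * C + |lam| * T)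
    | succ n => exact picardStep_le hw (hc n) (hn n) hC' hs
  have hgeom : ∀ T : ℝ≥0, ∃ C, 0 ≤ C ∧ ∀ n, ∀ s ≤ T,
      dist (picardIter lam w n s) (picardIter lam w (n + 1) s) ≤ C * (1 / 2) ^ n := by
    intro T
    obtain ⟨B, L, hB0, hL0, hL, hB⟩ := hbound T
    have hstep : ∀ n, ∀ s ≤ T, |picardIter lam w n s - picardIter lam w (n + 1) s| ≤
        B * (1 / 2) ^ n * Real.exp (4 * L * s) := by
      intro n
      induction n with
      | zero =>
        intro s hs
        have h1 : (1 : ℝ) ≤ Real.exp (4 * L * s) := Real.one_le_exp (by positivity)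
        rw [show picardIter lam w 0 s = 0 from rfl, zero_sub, abs_neg, abs_of_nonneg (hn 1 s),
          pow_zero, mul_one]
        exact (hB 1 s hs).trans (le_mul_of_one_le_right hB0 h1)
      | succ n ih =>
        intro s hs
        refine (picardStep_sub_le hw (hc n) (hn n) (hc (n + 1)) (hn (n + 1)) hL0 (by positivity)
          hL (hB n) (hB (n + 1)) ih hs).trans_eq ?_
        ring
    refine ⟨B * Real.exp (4 * L * T), by positivity, fun n s hs => (hstep n s hs).trans ?_⟩
    have h1 : Real.exp (4 * L * s) ≤ Real.exp (4 * L * T) := by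
      have : (s : ℝ) ≤ T := by exact_mod_cast hs
      gcongr
    calc _ ≤ B * (1 / 2) ^ n * Real.exp (4 * L * T) := by gcongr
      _ = _ := by ring
  have hlim : ∀ t, ∃ y, Tendsto (fun n => picardIter lam w n t) atTop (𝓝 y) := fun t => by
    obtain ⟨C, -, hC⟩ := hgeom t
    exact cauchySeq_tendsto_of_complete
      (cauchySeq_of_le_geometric (1 / 2) C (by norm_num) fun n => hC n t le_rfl)
  choose z hz using hlim
  have hunif : ∀ T : ℝ≥0, ∃ C, 0 ≤ C ∧ ∀ n, ∀ s ≤ T, |picardIter lam w n s - z s| ≤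
      C * (1 / 2) ^ n := by
    intro T
    obtain ⟨C, hC0, hC⟩ := hgeom T
    refine ⟨2 * C, by positivity, fun n s hs => ?_⟩
    refine (dist_le_of_le_geometric_of_tendsto (1 / 2) C (by norm_num) (fun n => hC n s hs)
      (hz s) n).trans_eq ?_
    ring
  have htend : ∀ C : ℝ, Tendsto (fun n : ℕ => C * (1 / 2 : ℝ) ^ n) atTop (𝓝 0) := fun C => by
    simpa using (tendsto_pow_atTop_nhds_zero_of_lt_one (r := (1 / 2 : ℝ)) (by norm_num)
      (by norm_num)).const_mul C
  have hz0 : ∀ t, 0 ≤ z t := fun t => ge_of_tendsto' (hz t) fun n => hn n t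
  have hzc : Continuous z := by
    refine TendstoLocallyUniformly.continuous (F := picardIter lam w) (p := atTop) ?_ (.of_forall hc)
    rw [Metric.tendstoLocallyUniformly_iff]
    intro ε hε t
    obtain ⟨C, -, hC⟩ := hunif (t + 1)
    refine ⟨Iic (t + 1), Iic_mem_nhds (by simp), ?_⟩
    filter_upwards [(htend C).eventually_lt_const hε] with n hn s hs
    rw [dist_comm]
    exact (hC n s hs).trans_lt hn
  have hfix : ∀ t, picardStep lam w z t = z t := by
    intro t
    obtain ⟨B, L, hB0, hL0, hL, hB⟩ := hbound t
    obtain ⟨C, hC0, hC⟩ := hunif t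
    -- The shifted iterates tend to `z t` and, by the contraction estimate, also to `picardStep lam
    -- w z t`.
    refine tendsto_nhds_unique ?_ ((tendsto_add_atTop_iff_nat 1).2 (hz t))
    rw [tendsto_iff_dist_tendsto_zero]
    refine squeeze_zero (fun _ => dist_nonneg) (fun n => ?_)
      (htend (C / 2 * Real.exp (4 * L * t)))
    have h1 := picardStep_sub_le hw (hc n) (hn n) hzc hz0 hL0 (c := C * (1 / 2) ^ n)
      (by positivity) hL (hB n) (fun s hs => le_of_tendsto' (hz s) fun n => hB n s hs)
      (fun s hs => (hC n s hs).trans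
        (le_mul_of_one_le_right (by positivity) (Real.one_le_exp (by positivity)))) (le_refl t)
    refine h1.trans_eq ?_
    ring
  have hd := continuous_driven (lam := lam) hw hzc hz0
  have hd0 : driven lam w z 0 = 0 := by rw [driven_zero, hw0]
  refine ⟨z, runSup (driven lam w z), hzc, hz0, ?_, continuous_runSup hd, monotone_runSup hd, ?_, ?_,
    fun t => intervalIntegrable_drift lam hzc hz0 0 t, fun t => ?_⟩
  · rw [← hfix, picardStep, runSup_zero, hd0]
    simp
  · rw [runSup_zero, hd0, neg_zero]
  · simp_rw [← hfix]
    exact lintegral_add_runSup hd _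
  · conv_lhs => rw [← hfix t, picardStep, driven]
    ring

end existence

/-! ### Dependence on the driving path, and measurability through finite samples. -/

/-- Local Lipschitz dependence of a solution on the driving path. -/
lemma IsReflectedPath.exists_lipschitz {lam : ℝ} {w z k : ℝ≥0 → ℝ} (h : IsReflectedPath lam w z k)
    (t : ℝ≥0) : ∃ C, 0 ≤ C ∧ ∀ w' z' k' δ, IsReflectedPath lam w' z' k' → δ ≤ 1 →
      (∀ s ≤ t, |w s - w' s| ≤ δ) → |z t - z' t| ≤ C * δ ∧ |k t - k' t| ≤ C * δ := by
  obtain ⟨B, hB⟩ := (isCompact_Icc (a := 0) (b := t)).bddAbove_image h.z_cont.continuousOn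
  -- As `δ ≤ 1`, the other solution stays within `2` of `z`, hence below `B + 2`. In the constant `3
  -- + 2 * L * t`, the `3` is `2` from `z` plus `1` from `w`, and the rest comes from the drift.
  obtain ⟨L, hL0, hL⟩ := exists_lipschitz_α (|lam| + t) (B + 2)
  refine ⟨3 + 2 * L * t, by positivity, fun w' z' k' δ h' hδ1 hδ => ?_⟩
  have hδ0 : 0 ≤ δ := (abs_nonneg _).trans (hδ 0 zero_le)
  have hz : ∀ s ≤ t, |z s - z' s| ≤ 2 * δ := fun s hs =>
    h.abs_sub_le h' fun r hr => hδ r (hr.trans hs)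
  have hzB : ∀ s ≤ t, z s ≤ B := fun s hs => hB (mem_image_of_mem _ ⟨zero_le, hs⟩)
  have hint : |(∫ s in (0 : ℝ)..t, drift lam s (z s.toNNReal)) -
      ∫ s in (0 : ℝ)..t, drift lam s (z' s.toNNReal)| ≤ 2 * L * t * δ := by
    rw [← intervalIntegral.integral_sub (h.drift_integrable t) (h'.drift_integrable t),
      ← Real.norm_eq_abs]
    refine (intervalIntegral.norm_integral_le_of_norm_le_const (C := L * (2 * δ))
      fun s hs => ?_).trans_eq (by rw [sub_zero, abs_of_nonneg t.coe_nonneg]; ring)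
    rw [uIoc_of_le t.coe_nonneg] at hs
    have hst : s.toNNReal ≤ t := Real.toNNReal_le_iff_le_coe.2 hs.2
    have hμ : |lam - s| ≤ |lam| + t := (abs_sub _ _).trans (by rw [abs_of_pos hs.1]; linarith [hs.2])
    have hz1 := abs_le.1 (hz _ hst)
    have hz2 := hzB _ hst
    rw [drift, drift, sub_sub_sub_cancel_left, Real.norm_eq_abs]
    rcases le_total (z s.toNNReal) (z' s.toNNReal) with hle | hle
    · rw [abs_of_nonneg (sub_nonneg.2 (monotone_α _ hle))]
      refine (hL _ _ _ (h.z_nonneg _) hle (by linarith [hz1.1]) hμ).trans ?_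
      gcongr
      linarith [hz1.1]
    · rw [abs_sub_comm, abs_of_nonneg (sub_nonneg.2 (monotone_α _ hle))]
      refine (hL _ _ _ (h'.z_nonneg _) hle (by linarith) hμ).trans ?_
      gcongr
      linarith [hz1.2]
  have h1 := hz t le_rfl
  have h2 := hδ t le_rfl
  have e1 := h.equation t
  have e2 := h'.equation t
  have hp : 0 ≤ 2 * L * t * δ := by positivity
  refine ⟨by nlinarith, ?_⟩
  have e3 : k t - k' t = (z t - z' t) - (w t - w' t) -
      ((∫ s in (0 : ℝ)..t, drift lam s (z s.toNNReal)) -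
        ∫ s in (0 : ℝ)..t, drift lam s (z' s.toNNReal)) := by linarith
  rw [e3]
  refine (abs_sub _ _).trans ((add_le_add ((abs_sub _ _).trans (add_le_add h1 h2)) hint).trans_eq ?_)
  ring

/-- The times at which a path is sampled in its `N`-th Bernstein approximation on `[0, t]`. -/
def sampleTime (t : ℝ≥0) {N : ℕ} (i : Fin (N + 1)) : ℝ≥0 := (bernstein.z i : ℝ).toNNReal * t

lemma sampleTime_le (t : ℝ≥0) {N : ℕ} (i : Fin (N + 1)) : sampleTime t i ≤ t :=
  mul_le_of_le_one_left zero_le (Real.toNNReal_le_one.2 (bernstein.z i).2.2)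

/-- The point of the unit interval that corresponds to the time `s` in `[0, t]`. -/
def unitTime (t s : ℝ≥0) : unitInterval := projIcc 0 1 zero_le_one ((s : ℝ) / t)

/-- The Bernstein interpolation on `[0, t]` of the increments of the samples `v`. -/
def samplePath (t : ℝ≥0) {N : ℕ} (v : Fin (N + 1) → ℝ) (s : ℝ≥0) : ℝ :=
  ∑ i : Fin (N + 1), bernstein N i (unitTime t s) * (v i - v 0)

lemma continuous_samplePath (t : ℝ≥0) {N : ℕ} (v : Fin (N + 1) → ℝ) :
    Continuous (samplePath t v) := by
  have h : Continuous (unitTime t) := continuous_projIcc.comp (by fun_prop)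
  exact continuous_finsetSum _ fun i _ => ((bernstein N i).continuous.comp h).mul continuous_const

/-- Only the Bernstein polynomial of index `0` is nonzero at `0`, and its coefficient is `v 0 - v
0`. Hence every sample vector gives an admissible driving path. -/
lemma samplePath_zero (t : ℝ≥0) {N : ℕ} (v : Fin (N + 1) → ℝ) : samplePath t v 0 = 0 := by
  have h : unitTime t 0 = 0 := by simp [unitTime]
  simp [samplePath, h, Fin.sum_univ_succ, bernstein_apply]

lemma abs_samplePath_sub_le (t : ℝ≥0) {N : ℕ} (v v' : Fin (N + 1) → ℝ) (s : ℝ≥0) :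
    |samplePath t v s - samplePath t v' s| ≤ 2 * dist v v' := by
  rw [samplePath, samplePath, ← Finset.sum_sub_distrib]
  have h1 : ∀ i ∈ (Finset.univ : Finset (Fin (N + 1))), |bernstein N i (unitTime t s) * (v i - v 0) -
      bernstein N i (unitTime t s) * (v' i - v' 0)| ≤
      bernstein N i (unitTime t s) * (2 * dist v v') := fun i _ => by
    rw [← mul_sub, abs_mul, abs_of_nonneg bernstein_nonneg]
    refine mul_le_mul_of_nonneg_left ?_ bernstein_nonneg
    have e1 := dist_le_pi_dist v v' i
    have e2 := dist_le_pi_dist v v' 0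
    rw [Real.dist_eq] at e1 e2
    rw [sub_sub_sub_comm]
    exact (abs_sub _ _).trans (by linarith)
  refine (Finset.abs_sum_le_sum_abs _ _).trans ((Finset.sum_le_sum h1).trans_eq ?_)
  rw [← Finset.sum_mul, bernstein.probability, one_mul]

lemma exists_samplePath_near {w : ℝ≥0 → ℝ} (hw : Continuous w) (hw0 : w 0 = 0) (t : ℝ≥0) :
    ∃ δ : ℕ → ℝ, Tendsto δ atTop (𝓝 0) ∧ ∀ N, ∀ s ≤ t,
      |w s - samplePath t (fun i : Fin (N + 1) => w (sampleTime t i)) s| ≤ δ N := by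
  let f : C(unitInterval, ℝ) := ⟨fun x => w ((x : ℝ).toNNReal * t), by fun_prop⟩
  refine ⟨fun N => dist f (bernsteinApproximation N f), ?_, fun N s hs => ?_⟩
  · simpa [dist_comm] using tendsto_iff_dist_tendsto_zero.1 (bernsteinApproximation_uniform f)
  · have h1 : f (unitTime t s) = w s := by
      have h2 : (s : ℝ) / t ∈ Icc (0 : ℝ) 1 :=
        ⟨by positivity, div_le_one_of_le₀ (by exact_mod_cast hs) t.coe_nonneg⟩
      have h3 : ((s : ℝ) / t).toNNReal * t = s := by
        rw [← NNReal.coe_div, Real.toNNReal_coe]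
        rcases eq_or_ne t 0 with rfl | ht
        · simp [le_antisymm hs zero_le]
        · exact div_mul_cancel₀ s ht
      simp only [f, ContinuousMap.coe_mk, unitTime, projIcc_of_mem zero_le_one h2, h3]
    have h2 : bernsteinApproximation N f (unitTime t s) =
        samplePath t (fun i : Fin (N + 1) => w (sampleTime t i)) s := by
      simp [bernsteinApproximation.apply, samplePath, f, sampleTime, hw0]
    rw [← h1, ← h2, ← Real.dist_eq]
    exact ContinuousMap.dist_apply_le_dist _

/-- The value at time `t` of the solution driven by the interpolation of the samples `v`. -/
def sampledSolution (lam : ℝ) (t : ℝ≥0) {N : ℕ} (v : Fin (N + 1) → ℝ) : ℝ × ℝ :=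
  ((exists_isReflectedPath lam (continuous_samplePath t v) (samplePath_zero t v)).choose t,
    (exists_isReflectedPath lam (continuous_samplePath t v)
      (samplePath_zero t v)).choose_spec.choose t)

lemma exists_sampledSolution_eq (lam : ℝ) (t : ℝ≥0) {N : ℕ} (v : Fin (N + 1) → ℝ) :
    ∃ z k, IsReflectedPath lam (samplePath t v) z k ∧ sampledSolution lam t v = (z t, k t) :=
  ⟨_, _, (exists_isReflectedPath lam (continuous_samplePath t v)
    (samplePath_zero t v)).choose_spec.choose_spec, rfl⟩

/-- No measurable selection is needed: the Lipschitz estimate holds whichever solutions were chosen.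
-/
lemma continuous_sampledSolution (lam : ℝ) (t : ℝ≥0) {N : ℕ} :
    Continuous (sampledSolution lam t : (Fin (N + 1) → ℝ) → ℝ × ℝ) := by
  refine continuous_iff_continuousAt.2 fun v => ?_
  obtain ⟨z, k, h, hv⟩ := exists_sampledSolution_eq lam t v
  obtain ⟨C, hC0, hC⟩ := h.exists_lipschitz t
  have hlim : Tendsto (fun v' => 2 * dist v v') (𝓝 v) (𝓝 0) := by
    have : Continuous fun v' => 2 * dist v v' := by fun_prop
    simpa using this.tendsto v
  rw [ContinuousAt, tendsto_iff_dist_tendsto_zero]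
  refine squeeze_zero' (.of_forall fun _ => dist_nonneg) ?_ (by simpa using hlim.const_mul C)
  filter_upwards [hlim.eventually_le_const one_pos] with v' h1
  obtain ⟨z', k', h', hv'⟩ := exists_sampledSolution_eq lam t v'
  have := hC _ _ _ _ h' h1 fun s _ => abs_samplePath_sub_le t v v' s
  rw [hv, hv', dist_comm]
  exact max_le this.1 this.2

lemma IsReflectedPath.tendsto_sampledSolution {lam : ℝ} {w z k : ℝ≥0 → ℝ}
    (h : IsReflectedPath lam w z k) (hw : Continuous w) (t : ℝ≥0) :
    Tendsto (fun N => sampledSolution lam t (fun i : Fin (N + 1) => w (sampleTime t i))) atTop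
      (𝓝 (z t, k t)) := by
  obtain ⟨C, hC0, hC⟩ := h.exists_lipschitz t
  obtain ⟨δ, hδ, hδle⟩ := exists_samplePath_near hw h.w_zero t
  rw [tendsto_iff_dist_tendsto_zero]
  refine squeeze_zero' (.of_forall fun _ => dist_nonneg) ?_ (by simpa using hδ.const_mul C)
  filter_upwards [hδ.eventually_le_const one_pos] with N h1
  obtain ⟨z', k', h', hv'⟩ := exists_sampledSolution_eq lam t
    (fun i : Fin (N + 1) => w (sampleTime t i))
  have := hC _ _ _ _ h' h1 (hδle N)
  rw [hv', dist_comm]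
  exact max_le this.1 this.2

lemma measurable_sampledSolution {Ω : Type*} [MeasurableSpace Ω] {W : ℝ≥0 → Ω → ℝ}
    (hWm : ∀ t, StronglyMeasurable (W t)) (lam : ℝ) (t : ℝ≥0) (N : ℕ) :
    Measurable[Filtration.natural W hWm t] fun ω =>
      sampledSolution lam t (fun i : Fin (N + 1) => W (sampleTime t i) ω) := by
  refine (continuous_sampledSolution lam t).measurable.comp
    (@measurable_pi_lambda _ _ _ (Filtration.natural W hWm t) _ _ fun i => ?_)
  exact ((Filtration.stronglyAdapted_natural hWm (sampleTime t i)).measurable).mono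
    ((Filtration.natural W hWm).mono (sampleTime_le t i)) le_rfl

end ForestDiffusion

end

/-! ### The theorem for Brownian motion. -/

/-- The solution is adapted to the natural filtration of `W` itself; uniqueness, up to
indistinguishability, is among all pairs adapted to the `P`-completion of that filtration
(`X t` agrees almost surely with a variable measurable at time `t`). -/
theorem mainTheorem5 {Ω : Type*} [MeasurableSpace Ω] (P : Measure Ω)
    (W : ℝ≥0 → Ω → ℝ) (hW : IsBrownianReal W P) (hWm : ∀ t, StronglyMeasurable (W t)) (lam : ℝ) :
    ∃ Z K : ℝ≥0 → Ω → ℝ,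
      Adapted (Filtration.natural W hWm) Z ∧
      Adapted (Filtration.natural W hWm) K ∧
      ForestDiffusion.IsReflectedSolution P lam W Z K ∧
      ∀ Z' K' : ℝ≥0 → Ω → ℝ,
        (∀ t, AEStronglyMeasurable[Filtration.natural W hWm t] (Z' t) P) →
        (∀ t, AEStronglyMeasurable[Filtration.natural W hWm t] (K' t) P) →
        ForestDiffusion.IsReflectedSolution P lam W Z' K' →
        ∀ᵐ ω ∂P, ∀ t, Z' t ω = Z t ω ∧ K' t ω = K t ω := by
  let S : ℝ≥0 → ℕ → Ω → ℝ × ℝ := fun t N ω =>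
    ForestDiffusion.sampledSolution lam t
      (fun i : Fin (N + 1) => W (ForestDiffusion.sampleTime t i) ω)
  have hS := ForestDiffusion.measurable_sampledSolution hWm lam
  -- The lower limit is measurable at time `t` on all of `Ω` and equals the limit wherever the path
  -- is continuous and starts at `0`. No null set is altered, so the filtration needs no completion.
  let Z : ℝ≥0 → Ω → ℝ := fun t ω => Filter.liminf (fun N => (S t N ω).1) Filter.atTop
  let K : ℝ≥0 → Ω → ℝ := fun t ω => Filter.liminf (fun N => (S t N ω).2) Filter.atTop
  have hsol : ForestDiffusion.IsReflectedSolution P lam W Z K := by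
    filter_upwards [hW.cont, hW.eval_zero_ae_eq_zero] with ω hc h0
    obtain ⟨z, k, h⟩ := ForestDiffusion.exists_isReflectedPath lam hc h0
    have hz : (fun t => Z t ω) = z := funext fun t =>
      ((continuous_fst.tendsto _).comp (h.tendsto_sampledSolution hc t)).liminf_eq
    have hk : (fun t => K t ω) = k := funext fun t =>
      ((continuous_snd.tendsto _).comp (h.tendsto_sampledSolution hc t)).liminf_eq
    rwa [hz, hk]
  refine ⟨Z, K, fun t => Measurable.liminf fun N => measurable_fst.comp (hS t N),
    fun t => Measurable.liminf fun N => measurable_snd.comp (hS t N), hsol,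
    fun Z' K' _ _ h' => ?_⟩
  filter_upwards [hsol, h'] with ω h1 h2 t
  have := h2.unique h1
  exact ⟨congrFun this.1 t, congrFun this.2 t⟩
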